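/- For $n\ge 0$ let $B_n$ be the algebra on $\{0,1,\dots,2^n-1\}$ with the binary operation $\backslash_n$ given by the recursion $0\backslash_n y=y$; $\;x\backslash_n(2^n-1)=x-1$ for $x>0$; $\;x\backslash_n(y-1)=(x\backslash_n y)\backslash_n(x-1)$ for $x,y>0$ (the recursion is well founded because $x\backslash_n y<x$ whenever $x>0$). Each $B_n$ is a subalgebra of $B_{n+1}$; let $B_\infty=\bigcup_n B_n$, an algebra on the nonnegative integers with operation $\backslash$, so that $x\backslash y=x\backslash_n y$ for every $n$ with $x,y<2^n$. For $x>0$ the sequence $x\backslash 0,\,x\backslash 1,\,x\backslash 2,\dots$ is periodic; its least positive period is called the period length of $x$. **Lemma 4.4.** Let $x,s,l$ be nonnegative integers such that $2^s\mid x$, the period length of $x+1$ is $2^l$, and $l\le 2^k$ for some $k\ge 0$ with $2^k\mid s$. Then $$(x+2^s)\backslash(2^s i+i')=\bigl((x+1)\backslash i\bigr)+i'$$ for all integers $i\ge 0$ and all integers $i'$ with $0\le i'<2^s$, and the period length of $x+2^s$ is $2^{l+s}$. -/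

import Mathlib

namespace LaverB

/-- The recursion defining the backward Laver tables, with `N` in the role of `2 ^ n`:
`0 \ y = y`, `x \ (N - 1) = x - 1` for `x > 0`, and `x \ y = (x \ (y + 1)) \ (x - 1)` for `x > 0`
and `y + 1 < N`.  The value is bundled with the facts `0 \ y = y` and `x \ y < x` (for `x ≠ 0`),
which are what makes the recursion well founded.  Arguments `y ≥ N` are outside the table and
never used. -/
def opAux (N : ℕ) : (x y : ℕ) → {z : ℕ // (x = 0 → z = y) ∧ (x ≠ 0 → z < x)}
  | 0, y => ⟨y, fun _ => rfl, fun h => absurd rfl h⟩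
  | x + 1, y =>
    if _h : y + 1 < N then
      let z := opAux N (x + 1) (y + 1)
      have hz : z.1 < x + 1 := z.2.2 (Nat.succ_ne_zero x)
      let w := opAux N z.1 x
      ⟨w.1, fun h => absurd h (Nat.succ_ne_zero x), fun _ => by
        by_cases h0 : z.1 = 0
        · exact (w.2.1 h0).trans_lt (Nat.lt_succ_self x)
        · exact (w.2.2 h0).trans hz⟩
    else ⟨x, fun h => absurd h (Nat.succ_ne_zero x), fun _ => Nat.lt_succ_self x⟩
termination_by x y => (x, N - y)
decreasing_by
  · exact Prod.Lex.right _ (by omega)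
  · exact Prod.Lex.left _ _ hz

/-- The operation `x \ₙ y` of the algebra `Bₙ` on `{0, 1, …, 2 ^ n - 1}`
(meaningful for `x, y < 2 ^ n`). -/
def op (n x y : ℕ) : ℕ := (opAux (2 ^ n) x y).1

theorem op_zero (n y : ℕ) : op n 0 y = y := by
  unfold op opAux
  rfl

theorem op_last (n x : ℕ) (hx : 0 < x) : op n x (2 ^ n - 1) = x - 1 := by
  obtain ⟨x, rfl⟩ := Nat.exists_eq_succ_of_ne_zero hx.ne'
  have hN : 0 < 2 ^ n := by positivity
  unfold op opAux
  rw [dif_neg (by omega)]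
  rfl

theorem op_pred (n x y : ℕ) (hx : 0 < x) (hy : 0 < y) (hyn : y < 2 ^ n) :
    op n x (y - 1) = op n (op n x y) (x - 1) := by
  obtain ⟨x, rfl⟩ := Nat.exists_eq_succ_of_ne_zero hx.ne'
  obtain ⟨y, rfl⟩ := Nat.exists_eq_succ_of_ne_zero hy.ne'
  conv_lhs => unfold op opAux
  simp only [Nat.succ_eq_add_one, Nat.add_sub_cancel] at hyn ⊢
  rw [dif_pos hyn]
  rfl

theorem op_lt_left (n x y : ℕ) (hx : x ≠ 0) : op n x y < x :=
  (opAux (2 ^ n) x y).2.2 hx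

theorem op_lt (n x y : ℕ) (hx : x < 2 ^ n) (hy : y < 2 ^ n) : op n x y < 2 ^ n := by
  rcases eq_or_ne x 0 with rfl | h
  · rwa [op_zero]
  · exact (op_lt_left n x y h).trans hx

/-- The operation `x \ y` of the algebra `B_∞ = ⋃ₙ Bₙ` on the natural numbers.  It is computed in
the smallest `Bₙ` that contains both `x` and `y`: `Nat.size (max x y)` is the least `n` such that
`x < 2 ^ n` and `y < 2 ^ n`. -/
def bs (x y : ℕ) : ℕ := op (Nat.size (max x y)) x y

/-- `x` has period length `p` in `B_∞`: `p` is the least positive period of the sequence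
`x \ 0, x \ 1, x \ 2, …`. -/
def HasPeriodLength (x p : ℕ) : Prop :=
  IsLeast {q : ℕ | 0 < q ∧ Function.Periodic (bs x) q} p

end LaverB

/-! Negation turns `bs` into the Laver operation * on Z/2^n, with a*1 = a+1 and with 0 in the role
of 2^n. It is left distributive, and the zeros of each row are the multiples of a power of 2. Hence
the level of a*b (its 2-adic valuation, capped at n) depends only on a and the level of b. The
resulting map `lv a` behaves like an elementary embedding acting on critical points: it is strictly
increasing until it reaches n, fixes levels below `lev a`, raises the levels from `lev a` up to n -
1, and satisfies lv (a*b) (lv a t) = lv a (lv b t).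

Put a = -(x+2^s) and y = -(x+1), the two ends of a block of 2^s consecutive elements. The lemma
becomes a*(2^s f + i) = y*(f+1) - 2^s + i for 0 < i ≤ 2^s. Modulo 2^(s+2^k), where 2^k ∣ s, the
products (2^s-1)*f and e*i (with 2^s ∣ e) are simply 2^s f and e+i; this rests on `growth` and
`shift`, proved by a joint induction. The period hypothesis makes a insensitive to multiples of
2^(s+2^k), so distributivity gives a*(2^s f + i) = (a*(2^s f))*(a*i) = (y*f)*(a+i) (`star_base`).

What remains is exact information on the block: a*i = a+i, which follows from `Rows`, and the value
of (y*f)*(a+i), which is `Cols`. Both come from `rowShape`, a nested induction on s, n, the element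
y and the position in the block. -/

namespace LaverB

/-! ### The Laver operation on Z/2^n -/

/-- The carrier of the `n`-th Laver table, with its ring structure. -/
abbrev Z (n : ℕ) := ZMod (2 ^ n)

/-- The usual Laver table operation on `ZMod (2 ^ n)`, obtained from `op` by negation. -/
def star {n : ℕ} (a b : Z n) : Z n := -((op n (-a).val (-b).val : ℕ) : Z n)

/-- The element of the backward table corresponding to `a`. -/
def wt {n : ℕ} (a : Z n) : ℕ := (-a).val

theorem wt_lt {n : ℕ} (a : Z n) : wt a < 2 ^ n := ZMod.val_lt _

theorem wt_eq_zero {n : ℕ} {a : Z n} : wt a = 0 ↔ a = 0 := by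
  simp [wt]

theorem star_zero_left {n : ℕ} (b : Z n) : star 0 b = b := by
  simp [star, op_zero]

theorem wt_star_lt {n : ℕ} {a : Z n} (ha : a ≠ 0) (b : Z n) : wt (star a b) < wt a := by
  have h0 : (-a).val ≠ 0 := fun h => ha (wt_eq_zero.1 h)
  have h1 := op_lt_left n (-a).val (-b).val h0
  have h2 : op n (-a).val (-b).val < 2 ^ n := h1.trans (ZMod.val_lt _)
  unfold wt star
  rw [neg_neg, ZMod.val_natCast_of_lt h2]
  exact h1

theorem val_sub_one {n : ℕ} {c : Z n} (hc : c ≠ 0) : (c - 1).val = c.val - 1 := by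
  have h0 : 0 < c.val := Nat.pos_of_ne_zero (by simpa using hc)
  have h1 : c - 1 = ((c.val - 1 : ℕ) : Z n) := by
    rw [Nat.cast_sub h0, ZMod.natCast_zmod_val]; simp
  rw [h1, ZMod.val_natCast_of_lt]
  have := ZMod.val_lt c
  omega

theorem val_neg_one_eq (n : ℕ) : (-1 : Z n).val = 2 ^ n - 1 := by
  have h0 : 0 < 2 ^ n := by positivity
  have h1 : (-1 : Z n) = ((2 ^ n - 1 : ℕ) : Z n) := by
    rw [Nat.cast_sub h0, ZMod.natCast_self]; simp
  rw [h1, ZMod.val_natCast_of_lt (by omega)]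

theorem star_one {n : ℕ} (a : Z n) : star a 1 = a + 1 := by
  rcases eq_or_ne a 0 with rfl | ha
  · simp [star_zero_left]
  have h0 : 0 < (-a).val := Nat.pos_of_ne_zero fun h => ha (wt_eq_zero.1 h)
  rw [star, val_neg_one_eq, op_last _ _ h0, Nat.cast_sub h0, ZMod.natCast_zmod_val]
  push_cast; ring

theorem star_succ_of_ne {n : ℕ} (a : Z n) {b : Z n} (hb : b ≠ 0) :
    star a (b + 1) = star (star a b) (a + 1) := by
  rcases eq_or_ne a 0 with rfl | ha
  · simp [star_zero_left, star_one]
  have h0 : 0 < (-a).val := Nat.pos_of_ne_zero fun h => ha (wt_eq_zero.1 h)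
  have h1 : 0 < (-b).val := Nat.pos_of_ne_zero fun h => hb (wt_eq_zero.1 h)
  have h2 : op n (-a).val (-b).val < 2 ^ n :=
    (op_lt_left n _ _ h0.ne').trans (ZMod.val_lt _)
  have e1 : (-(b + 1)).val = (-b).val - 1 := by
    rw [neg_add, ← sub_eq_add_neg, val_sub_one (neg_ne_zero.2 hb)]
  have e2 : (-(a + 1)).val = (-a).val - 1 := by
    rw [neg_add, ← sub_eq_add_neg, val_sub_one (neg_ne_zero.2 ha)]
  unfold star
  rw [e1, e2, neg_neg, ZMod.val_natCast_of_lt h2, op_pred _ _ _ h0 h1 (ZMod.val_lt _)]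

/-! ### Zeros of rows, and reduction modulo smaller powers of 2 -/

/-- The element `a` annihilates exactly the multiples of `2 ^ p`. -/
def HasPer {n : ℕ} (a : Z n) (p : ℕ) : Prop := ∀ b : ℕ, star a (b : Z n) = 0 ↔ 2 ^ p ∣ b

/-- Reduction modulo `2 ^ m`. -/
def red {n m : ℕ} (h : m ≤ n) : Z n →+* Z m := ZMod.castHom (pow_dvd_pow 2 h) (Z m)

theorem red_eq_zero {n m : ℕ} (h : m ≤ n) (a : Z n) : red h a = 0 ↔ (2 ^ m : Z n) ∣ a := by
  constructor
  · intro h1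
    rw [red, ZMod.castHom_apply, ← ZMod.natCast_val, ZMod.natCast_eq_zero_iff] at h1
    obtain ⟨c, hc⟩ := h1
    refine ⟨c, ?_⟩
    rw [← ZMod.natCast_zmod_val a, hc]; push_cast; rfl
  · rintro ⟨c, rfl⟩
    have : (2 : Z m) ^ m = 0 := by
      have := ZMod.natCast_self (2 ^ m); push_cast at this; exact this
    rw [map_mul, map_pow, map_ofNat, this, zero_mul]

theorem natCast_ne_zero_of_lt {n j : ℕ} (h0 : 0 < j) (h : j < 2 ^ n) : (j : Z n) ≠ 0 := by
  intro h1
  rw [ZMod.natCast_eq_zero_iff] at h1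
  exact absurd (Nat.le_of_dvd h0 h1) (by omega)

theorem star_zero_of_hasPer {n : ℕ} (H : ∀ a : Z n, ∃ p, p ≤ n ∧ HasPer a p) (a : Z n) :
    star a 0 = 0 := by
  obtain ⟨p, -, hp⟩ := H a
  simpa using (hp 0).2 (dvd_zero _)

theorem star_succ_of_zero {n : ℕ} (H : ∀ a : Z n, star a 0 = 0) (a b : Z n) :
    star a (b + 1) = star (star a b) (a + 1) := by
  rcases eq_or_ne b 0 with rfl | hb
  · rw [H, star_zero_left, zero_add, star_one]
  · exact star_succ_of_ne a hb

/-- Both sides obey the same recursion, by induction on `wt a` and then on j. The value j = 0 is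
left out because a*0 = 0 is not yet known in the larger table; there 0 is represented by 2^(n+1). -/
theorem red_star_of_zero {n : ℕ} (H : ∀ a : Z n, star a 0 = 0) (a : Z (n + 1)) :
    ∀ j : ℕ, 0 < j → j ≤ 2 ^ (n + 1) →
      red n.le_succ (star a (j : Z (n + 1))) = star (red n.le_succ a) (j : Z n) := by
  induction hw : wt a using Nat.strong_induction_on generalizing a with
  | _ w ih =>
    rcases eq_or_ne a 0 with rfl | ha
    · intro j _ _; simp [star_zero_left]
    intro j
    induction j with
    | zero => intro h; omega
    | succ j ihj =>
      intro _ hj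
      rcases Nat.eq_zero_or_pos j with rfl | hj0
      · simp [star_one]
      push_cast
      rw [star_succ_of_ne _ (natCast_ne_zero_of_lt hj0 (by omega)), star_succ_of_zero H,
        ← ihj hj0 (by omega)]
      have h2 : ∃ i : ℕ, 0 < i ∧ i ≤ 2 ^ (n + 1) ∧ (i : Z (n + 1)) = a + 1 := by
        rcases eq_or_ne (a + 1) 0 with h | h
        · exact ⟨2 ^ (n + 1), by positivity, le_rfl, by rw [h, ZMod.natCast_self]⟩
        · exact ⟨(a + 1).val, Nat.pos_of_ne_zero (by simpa using h), (ZMod.val_lt _).le, by simp⟩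
      obtain ⟨i, hi0, hi1, hi2⟩ := h2
      rw [← hi2, ih _ (hw ▸ wt_star_lt ha _) _ rfl i hi0 hi1]
      have : (i : Z n) = red n.le_succ a + 1 := by
        rw [← map_one (red n.le_succ), ← map_add, ← hi2, map_natCast]
      rw [this]

theorem eq_zero_or_of_red {n : ℕ} {a : Z (n + 1)} (h : red n.le_succ a = 0) :
    a = 0 ∨ a = 2 ^ n := by
  rw [red_eq_zero] at h
  obtain ⟨c, rfl⟩ := h
  have h2 : (2 : Z (n + 1)) ^ n * 2 = 0 := by
    have := ZMod.natCast_self (2 ^ (n + 1)); push_cast at this; rw [← pow_succ]; exact this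
  rcases Nat.even_or_odd' c.val with ⟨d, hd | hd⟩
  · left
    rw [← ZMod.natCast_zmod_val c, hd]; push_cast; rw [← mul_assoc, h2, zero_mul]
  · right
    rw [← ZMod.natCast_zmod_val c, hd]; push_cast; rw [mul_add, ← mul_assoc, h2]; simp

theorem star_add_of_eq_zero {n : ℕ} (a : Z n) {i : ℕ} (hi : star a (i : Z n) = 0) (j : ℕ)
    (hj : 0 < j) (hij : i + j ≤ 2 ^ n) : star a ((i + j : ℕ) : Z n) = star a (j : Z n) := by
  rcases Nat.eq_zero_or_pos i with rfl | hi0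
  · simp
  induction j with
  | zero => omega
  | succ j ih =>
    rcases Nat.eq_zero_or_pos j with rfl | hj0
    · push_cast
      rw [star_succ_of_ne _ (natCast_ne_zero_of_lt hi0 (by omega)), hi]; simp [star_zero_left, star_one]
    · rw [← add_assoc]
      push_cast [← Nat.cast_add]
      rw [star_succ_of_ne _ (natCast_ne_zero_of_lt (by omega) (by omega)),
        star_succ_of_ne _ (natCast_ne_zero_of_lt hj0 (by omega)), ih hj0 (by omega)]

theorem wt_star_add_lt {n : ℕ} (a : Z n) {i : ℕ} (hi : 0 < i) (j : ℕ) (hij : i + j ≤ 2 ^ n)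
    (hne : ∀ t, t < j → star a ((i + t : ℕ) : Z n) ≠ 0) :
    wt (star a ((i + j : ℕ) : Z n)) + j ≤ wt (star a (i : Z n)) := by
  induction j with
  | zero => simp
  | succ j ih =>
    have h1 := ih (by omega) (fun t ht => hne t (by omega))
    have h2 : star a ((i + (j + 1) : ℕ) : Z n) = star (star a ((i + j : ℕ) : Z n)) (a + 1) := by
      rw [← star_succ_of_ne _ (natCast_ne_zero_of_lt (by omega) (by omega))]
      push_cast; ring_nf
    rw [h2]
    have h3 := wt_star_lt (hne j (by omega)) (a + 1)
    omega

theorem hasPer_of_first {n : ℕ} {a : Z n} {q : ℕ} (hq : q ≤ n)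
    (h0 : star a ((2 ^ q : ℕ) : Z n) = 0)
    (hne : ∀ j : ℕ, 0 < j → j < 2 ^ q → star a (j : Z n) ≠ 0) : HasPer a q := by
  have hpos : 0 < 2 ^ q := by positivity
  have key : ∀ j : ℕ, 0 < j → j ≤ 2 ^ n → (star a (j : Z n) = 0 ↔ 2 ^ q ∣ j) := by
    intro j
    induction j using Nat.strong_induction_on with
    | _ j ih =>
      intro hj0 hj
      rcases lt_trichotomy j (2 ^ q) with h | h | h
      · exact ⟨fun h1 => absurd h1 (hne j hj0 h), fun h1 => absurd (Nat.le_of_dvd hj0 h1) (by omega)⟩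
      · rw [h]; exact ⟨fun _ => dvd_rfl, fun _ => h0⟩
      · have h1 := star_add_of_eq_zero a h0 (j - 2 ^ q) (by omega) (by omega)
        rw [show 2 ^ q + (j - 2 ^ q) = j by omega] at h1
        rw [h1, ih (j - 2 ^ q) (by omega) (by omega) (by omega)]
        exact Nat.dvd_sub_self_right.trans (by simp [Nat.not_le.2 h])
  intro b
  have hn : (2 : ℕ) ^ q ∣ 2 ^ n := pow_dvd_pow 2 hq
  rcases Nat.eq_zero_or_pos (b % 2 ^ n) with h | h
  · have h1 : (b : Z n) = ((2 ^ n : ℕ) : Z n) := by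
      rw [ZMod.natCast_self, ZMod.natCast_eq_zero_iff]; exact Nat.dvd_of_mod_eq_zero h
    rw [h1, key _ (by positivity) le_rfl]
    exact ⟨fun _ => hn.trans (Nat.dvd_of_mod_eq_zero h), fun _ => hn⟩
  · have h1 : (b : Z n) = ((b % 2 ^ n : ℕ) : Z n) := by rw [ZMod.natCast_mod]
    rw [h1, key _ h (Nat.mod_lt _ (by positivity)).le]
    exact Nat.dvd_mod_iff hn

/-- At multiples of 2^p the row of a reduces to 0, so it takes only the values 0 and 2^n. If 2^n
occurs at 2^p, weights decrease strictly until a zero is met, so 2^n cannot recur at 2^(p+1). -/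
theorem hasPer_step {n : ℕ} (H : ∀ a : Z n, ∃ p, p ≤ n ∧ HasPer a p) (a : Z (n + 1)) {p : ℕ}
    (hpn : p ≤ n) (hp : HasPer (red n.le_succ a) p) : HasPer a p ∨ HasPer a (p + 1) := by
  have hz := star_zero_of_hasPer H
  have hpos : 0 < 2 ^ p := by positivity
  have hle : 2 ^ p ≤ 2 ^ n := Nat.pow_le_pow_right (by norm_num) hpn
  have e1 : 2 ^ (n + 1) = 2 * 2 ^ n := by ring
  have e2 : 2 ^ (p + 1) = 2 * 2 ^ p := by ring
  have hnd : ∀ j : ℕ, 0 < j → j ≤ 2 ^ (n + 1) → ¬ 2 ^ p ∣ j → star a (j : Z (n + 1)) ≠ 0 := by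
    intro j h1 h2 h3 h4
    have := red_star_of_zero hz a j h1 h2
    rw [h4, map_zero] at this
    exact h3 ((hp j).1 this.symm)
  have hd : ∀ j : ℕ, 0 < j → j ≤ 2 ^ (n + 1) → 2 ^ p ∣ j →
      star a (j : Z (n + 1)) = 0 ∨ star a (j : Z (n + 1)) = 2 ^ n := by
    intro j h1 h2 h3
    apply eq_zero_or_of_red
    rw [red_star_of_zero hz a j h1 h2]
    exact (hp j).2 h3
  have hsmall : ∀ j : ℕ, 0 < j → j < 2 ^ p → ¬ 2 ^ p ∣ j := fun j h1 h2 h3 =>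
    absurd (Nat.le_of_dvd h1 h3) (by omega)
  have hΩ : (2 : Z (n + 1)) ^ n ≠ 0 := by
    have := natCast_ne_zero_of_lt (n := n + 1) (j := 2 ^ n) (by positivity) (by omega)
    push_cast at this; exact this
  rcases hd (2 ^ p) hpos (by omega) dvd_rfl with h | h
  · left
    exact hasPer_of_first (by omega) h fun j h1 h2 => hnd j h1 (by omega) (hsmall j h1 h2)
  · right
    have hne : ∀ t, t < 2 ^ p → star a ((2 ^ p + t : ℕ) : Z (n + 1)) ≠ 0 := by
      intro t ht
      rcases Nat.eq_zero_or_pos t with rfl | ht0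
      · rw [add_zero, h]; exact hΩ
      · exact hnd _ (by omega) (by omega) fun h1 => hsmall t ht0 ht (by simpa using h1)
    refine hasPer_of_first (by omega) ?_ ?_
    · rcases hd (2 ^ (p + 1)) (by positivity) (by omega) (pow_dvd_pow 2 p.le_succ) with h1 | h1
      · exact h1
      · have := wt_star_add_lt a hpos (2 ^ p) (by omega) hne
        rw [show 2 ^ p + 2 ^ p = 2 ^ (p + 1) by omega, h1, h] at this
        omega
    · intro j h1 h2
      rcases lt_or_ge j (2 ^ p) with h3 | h3
      · exact hnd j h1 (by omega) (hsmall j h1 h3)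
      · have := hne (j - 2 ^ p) (by omega)
        rwa [show 2 ^ p + (j - 2 ^ p) = j by omega] at this

theorem exists_hasPer (n : ℕ) : ∀ a : Z n, ∃ p, p ≤ n ∧ HasPer a p := by
  induction n with
  | zero =>
    intro a
    refine ⟨0, le_rfl, fun b => ?_⟩
    have : Subsingleton (Z 0) := inferInstanceAs (Subsingleton (ZMod 1))
    simp [Subsingleton.elim (star a (b : Z 0)) 0]
  | succ n ih =>
    intro a
    obtain ⟨p, hpn, hp⟩ := ih (red n.le_succ a)
    rcases hasPer_step ih a hpn hp with h | h
    · exact ⟨p, by omega, h⟩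
    · exact ⟨p + 1, by omega, h⟩

theorem star_zero {n : ℕ} (a : Z n) : star a 0 = 0 := star_zero_of_hasPer (exists_hasPer n) a

theorem star_succ {n : ℕ} (a b : Z n) : star a (b + 1) = star (star a b) (a + 1) :=
  star_succ_of_zero star_zero a b

/-- Induction on `Z n` along `0, 1, 2, …`. -/
theorem Z.induction {n : ℕ} {P : Z n → Prop} (h0 : P 0) (hs : ∀ b, P b → P (b + 1)) (b : Z n) :
    P b := by
  have : ∀ j : ℕ, P (j : Z n) := by
    intro j
    induction j with
    | zero => simpa using h0
    | succ j ih => push_cast; exact hs _ ih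
  simpa using this b.val

theorem star_add {n : ℕ} {a d : Z n} (hd : star a d = 0) (c : Z n) :
    star a (d + c) = star a c := by
  induction c using Z.induction with
  | h0 => rw [add_zero, hd, star_zero]
  | hs c ih => rw [← add_assoc, star_succ, ih, ← star_succ]

theorem red_star_succ {n : ℕ} (a b : Z (n + 1)) :
    red n.le_succ (star a b) = star (red n.le_succ a) (red n.le_succ b) := by
  rcases eq_or_ne b 0 with rfl | hb
  · simp [star_zero]
  · have := red_star_of_zero star_zero a b.val (Nat.pos_of_ne_zero (by simpa using hb))
      (ZMod.val_lt _).le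
    rw [← map_natCast (red n.le_succ), ZMod.natCast_zmod_val] at this
    exact this

theorem red_red {n m l : ℕ} (h : m ≤ n) (h' : l ≤ m) (a : Z n) :
    red h' (red h a) = red (h'.trans h) a := by
  induction a using Z.induction with
  | h0 => simp
  | hs b ih => simp [ih]

theorem red_star {n m : ℕ} (h : m ≤ n) (a b : Z n) :
    red h (star a b) = star (red h a) (red h b) := by
  induction n, h using Nat.le_induction with
  | base =>
    have : ∀ a : Z m, red le_rfl a = a := fun a => by
      induction a using Z.induction with
      | h0 => simp
      | hs b ih => simp [ih]
    simp [this]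
  | succ n hmn ih =>
    rw [← red_red n.le_succ hmn, red_star_succ, ih, red_red, red_red]

/-! ### Distributivity and composition -/

/-- Left distributivity. -/
theorem star_distrib {n : ℕ} (a b c : Z n) :
    star a (star b c) = star (star a b) (star a c) := by
  induction hw : wt a using Nat.strong_induction_on generalizing a b c with
  | _ w iha =>
  rcases eq_or_ne a 0 with rfl | ha
  · simp only [star_zero_left]
  induction hv : wt b using Nat.strong_induction_on generalizing b c with
  | _ v ihb =>
  rcases eq_or_ne b 0 with rfl | hb
  · simp only [star_zero_left, star_zero]
  induction c using Z.induction with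
  | h0 => simp only [star_zero]
  | hs c ihc =>
    rw [star_succ b c, ihb _ (hv ▸ wt_star_lt hb c) _ _ rfl, ihc, star_succ a b,
      star_succ a c]
    -- Distributivity for a*b, which has smaller weight than a, read from right to left.
    exact (iha _ (hw ▸ wt_star_lt ha b) _ _ _ rfl).symm

/-- `a ∘ b = a * (b + 1) - 1` acts as the composition of `a` and `b`. -/
theorem star_comp {n : ℕ} (a b c : Z n) :
    star (star a (b + 1) - 1) c = star a (star b c) := by
  induction c using Z.induction with
  | h0 => simp only [star_zero]
  | hs c ih => rw [star_succ, ih, sub_add_cancel, ← star_distrib, ← star_succ]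

/-! ### Levels, and the action of elements on them -/

theorem two_pow_self (n : ℕ) : (2 : Z n) ^ n = 0 := by
  have := ZMod.natCast_self (2 ^ n); push_cast at this; exact this

theorem two_pow_eq_zero {n t : ℕ} (h : n ≤ t) : (2 : Z n) ^ t = 0 := by
  rw [← Nat.add_sub_cancel' h, pow_add, two_pow_self, zero_mul]

open Classical in
/-- The largest `t ≤ n` such that `2 ^ t` divides `a`. -/
noncomputable def lev {n : ℕ} (a : Z n) : ℕ := Nat.findGreatest (fun t => (2 : Z n) ^ t ∣ a) n

theorem lev_le {n : ℕ} (a : Z n) : lev a ≤ n := Nat.findGreatest_le _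

theorem two_pow_lev_dvd {n : ℕ} (a : Z n) : (2 : Z n) ^ lev a ∣ a := by
  classical
  exact Nat.findGreatest_spec (P := fun t => (2 : Z n) ^ t ∣ a) (Nat.zero_le n) (by simp)

theorem le_lev {n t : ℕ} (ht : t ≤ n) {a : Z n} : t ≤ lev a ↔ (2 : Z n) ^ t ∣ a := by
  classical
  exact ⟨fun h => (pow_dvd_pow 2 h).trans (two_pow_lev_dvd a), fun h => Nat.le_findGreatest ht h⟩

theorem lev_eq_iff {n : ℕ} {a : Z n} : lev a = n ↔ a = 0 := by
  rw [← zero_dvd_iff, ← two_pow_self n, ← le_lev le_rfl]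
  exact ⟨fun h => h.ge, fun h => le_antisymm (lev_le a) h⟩

theorem lev_zero (n : ℕ) : lev (0 : Z n) = n := lev_eq_iff.2 rfl

theorem lev_ext {n m : ℕ} {a : Z n} {b : Z n} (hm : lev a ≤ m) (hm' : lev b ≤ m)
    (h : ∀ r, r ≤ m → (r ≤ lev a ↔ r ≤ lev b)) : lev a = lev b :=
  le_antisymm ((h _ hm).1 le_rfl) ((h _ hm').2 le_rfl)

theorem two_pow_dvd_natCast {n t : ℕ} (ht : t ≤ n) (b : ℕ) :
    (2 : Z n) ^ t ∣ (b : Z n) ↔ 2 ^ t ∣ b := by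
  rw [← red_eq_zero ht, map_natCast, ZMod.natCast_eq_zero_iff]

theorem lev_two_pow {n t : ℕ} (ht : t ≤ n) : lev ((2 : Z n) ^ t) = t := by
  apply le_antisymm
  · have h := two_pow_lev_dvd ((2 : Z n) ^ t)
    have h1 := (two_pow_dvd_natCast (lev_le ((2 : Z n) ^ t)) (2 ^ t)).1 (by push_cast; exact h)
    exact (Nat.pow_dvd_pow_iff_le_right (by norm_num)).1 h1
  · exact (le_lev ht).2 dvd_rfl

theorem lev_two_pow_of_le {n t : ℕ} (ht : n ≤ t) : lev ((2 : Z n) ^ t) = n := by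
  rw [two_pow_eq_zero ht, lev_zero]

theorem lev_add_eq {n : ℕ} {a b : Z n} (h : lev b < lev a) : lev (a + b) = lev b := by
  apply le_antisymm
  · by_contra! h1
    have h2 : (2 : Z n) ^ (lev b + 1) ∣ a + b :=
      (le_lev (by have := lev_le a; omega)).1 h1
    have h3 : (2 : Z n) ^ (lev b + 1) ∣ a := (le_lev (by have := lev_le a; omega)).1 h
    have h4 := (le_lev (by have := lev_le a; omega)).2 ((dvd_add_right h3).1 h2)
    omega
  · rw [le_lev (lev_le b)]
    exact dvd_add ((pow_dvd_pow 2 h.le).trans (two_pow_lev_dvd a)) (two_pow_lev_dvd b)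

theorem lev_red {n m : ℕ} (h : m ≤ n) (a : Z n) : lev (red h a) = min (lev a) m := by
  have key : ∀ t, t ≤ m → (t ≤ lev (red h a) ↔ t ≤ lev a) := by
    intro t ht
    rw [le_lev ht, le_lev (ht.trans h), ← red_eq_zero ht, red_red, red_eq_zero]
  apply le_antisymm
  · exact le_min ((key _ (lev_le _)).1 le_rfl) (lev_le _)
  · exact (key _ (min_le_right _ _)).2 (min_le_left _ _)

/-- Divisibility of a*b by 2^r is vanishing in the table of order 2^r, where the zeros form a
threshold condition on `lev b`. This is why a acts on levels at all. -/
theorem exists_dvd_star_iff {n r : ℕ} (hr : r ≤ n) (a : Z n) :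
    ∃ p, p ≤ r ∧ HasPer (red hr a) p ∧ ∀ b : Z n, (2 : Z n) ^ r ∣ star a b ↔ p ≤ lev b := by
  obtain ⟨p, hpr, hp⟩ := exists_hasPer r (red hr a)
  refine ⟨p, hpr, hp, fun b => ?_⟩
  rw [← red_eq_zero hr, red_star]
  have : red hr b = (b.val : Z r) := by rw [← map_natCast (red hr), ZMod.natCast_zmod_val]
  rw [this, hp, le_lev (hpr.trans hr), ← two_pow_dvd_natCast (hpr.trans hr) b.val,
    ZMod.natCast_zmod_val]

/-- The action of `a` on levels: the level of `a * 2 ^ t`. -/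
noncomputable def lv {n : ℕ} (a : Z n) (t : ℕ) : ℕ := lev (star a (2 ^ t))

theorem lv_le {n : ℕ} (a : Z n) (t : ℕ) : lv a t ≤ n := lev_le _

theorem lev_star {n : ℕ} (a b : Z n) : lev (star a b) = lv a (lev b) := by
  refine lev_ext (lev_le _) (lev_le _) fun r hr => ?_
  obtain ⟨p, hpr, -, hp⟩ := exists_dvd_star_iff hr a
  rw [le_lev hr, le_lev hr, hp, hp, lev_two_pow (lev_le b)]

theorem lv_star {n : ℕ} (a b : Z n) (t : ℕ) : lv (star a b) (lv a t) = lv a (lv b t) := by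
  change lv (star a b) (lev (star a (2 ^ t))) = lv a (lev (star b (2 ^ t)))
  rw [← lev_star, ← star_distrib, lev_star]

theorem lv_comp {n : ℕ} (a b : Z n) (t : ℕ) :
    lv (star a (b + 1) - 1) t = lv a (lv b t) := by
  rw [lv, star_comp, lev_star]; rfl

theorem lv_of_le {n : ℕ} (a : Z n) {t : ℕ} (ht : n ≤ t) : lv a t = n := by
  rw [lv, two_pow_eq_zero ht, star_zero, lev_zero]

theorem lev_two_pow_mono {n t t' : ℕ} (h : t ≤ t') : lev ((2 : Z n) ^ t) ≤ lev ((2 : Z n) ^ t') := by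
  rw [le_lev (lev_le _)]
  exact (two_pow_lev_dvd _).trans (pow_dvd_pow 2 h)

theorem lv_mono {n : ℕ} (a : Z n) {t t' : ℕ} (h : t ≤ t') : lv a t ≤ lv a t' := by
  obtain ⟨p, -, -, hp⟩ := exists_dvd_star_iff (lv_le a t) a
  rw [lv, lv, le_lev (lev_le _), ← lv, hp]
  refine le_trans ?_ (lev_two_pow_mono h)
  rw [← hp]
  exact two_pow_lev_dvd _

/-- Enlarging the modulus by one factor 2 raises the exponent of the period by at most one
(`hasPer_step`). -/
theorem lv_lt_succ {n : ℕ} (a : Z n) {t : ℕ} (h : lv a t < n) : lv a t < lv a (t + 1) := by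
  have ht : t < n := by
    by_contra! h1
    rw [lv_of_le a h1] at h; exact lt_irrefl _ h
  obtain ⟨p, hp1, hp2, hp3⟩ := exists_dvd_star_iff h.le a
  obtain ⟨q, hq1, hq2, hq3⟩ := exists_dvd_star_iff (Nat.succ_le_of_lt h) a
  have hpt : p ≤ t := by
    have := (hp3 (2 ^ t)).1 (two_pow_lev_dvd _)
    rwa [lev_two_pow ht.le] at this
  have h1 : red (lv a t).le_succ (red (Nat.succ_le_of_lt h) a) = red h.le a := red_red _ _ _
  have hqp : q ≤ p + 1 := by
    have hu : ∀ q', HasPer (red (Nat.succ_le_of_lt h) a) q' → 2 ^ q ∣ 2 ^ q' := fun q' hq' =>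
      (hq2 _).1 ((hq' _).2 dvd_rfl)
    have hu' : ∀ q', HasPer (red (Nat.succ_le_of_lt h) a) q' → q ≤ q' := fun q' hq' =>
      (Nat.pow_dvd_pow_iff_le_right (by norm_num)).1 (hu q' hq')
    rcases hasPer_step (exists_hasPer _) (red (Nat.succ_le_of_lt h) a) hp1 (h1 ▸ hp2) with h2 | h2
    · have := hu' _ h2; omega
    · exact hu' _ h2
  refine Nat.lt_of_succ_le ((le_lev (Nat.succ_le_of_lt h)).2 ((hq3 _).2 ?_))
  rw [lev_two_pow (Nat.succ_le_of_lt ht)]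
  omega

theorem lv_add {n : ℕ} (a : Z n) (t i : ℕ) : min n (lv a t + i) ≤ lv a (t + i) := by
  induction i with
  | zero => simp
  | succ i ih =>
    rcases lt_or_ge (lv a (t + i)) n with h | h
    · have := lv_lt_succ a h
      rw [← add_assoc t]; omega
    · have := lv_mono a (show t + i ≤ t + (i + 1) by omega)
      omega

theorem le_lv {n : ℕ} (a : Z n) {t : ℕ} (ht : t ≤ n) : t ≤ lv a t := by
  have := lv_add a 0 t
  rw [zero_add] at this
  omega

theorem lv_of_lt_lev {n : ℕ} {a : Z n} {t : ℕ} (h : t < lev a) : lv a t = t := by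
  have hn := lev_le a
  apply le_antisymm _ (le_lv a (by omega))
  by_contra! h1
  have h2 : (2 : Z n) ^ (t + 1) ∣ star a (2 ^ t) := (le_lev (by omega)).1 h1
  have h3 : (2 : Z n) ^ (t + 1) ∣ a := (le_lev (by omega)).1 h
  rw [← red_eq_zero (show t + 1 ≤ n by omega)] at h2 h3
  rw [red_star, h3, star_zero_left, red_eq_zero, ← le_lev (by omega), lev_two_pow (by omega)] at h2
  omega

theorem lv_zero_right {n : ℕ} (a : Z n) : lv a 0 = lev (a + 1) := by
  rw [lv, pow_zero, star_one]

/-- Otherwise the row has full period, and its 2^(n+1) - 1 nonzero values would have strictly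
decreasing positive weights, all below `wt a < 2 ^ (n + 1)`: there is no room for them. -/
theorem star_two_pow_pred {n : ℕ} {a : Z (n + 1)} (ha : a ≠ 0) : star a (2 ^ n) = 0 := by
  have h0 : red n.le_succ (star a (2 ^ n)) = 0 := by
    rw [red_star, map_pow, map_ofNat, two_pow_self, star_zero]
  rcases eq_zero_or_of_red h0 with h | h
  · exact h
  exfalso
  have e : 1 ≤ 2 ^ n := Nat.one_le_two_pow
  have hΩ : (2 : Z (n + 1)) ^ n ≠ 0 := by
    have := natCast_ne_zero_of_lt (n := n + 1) (j := 2 ^ n) (by positivity) (by omega)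
    push_cast at this; exact this
  obtain ⟨p, hp, hper⟩ := exists_hasPer (n + 1) a
  have hpn : p = n + 1 := by
    by_contra h1
    apply hΩ
    rw [← h]
    have := (hper (2 ^ n)).2 (pow_dvd_pow 2 (by omega))
    push_cast at this; exact this
  subst hpn
  have h2 := wt_star_add_lt a (i := 1) one_pos (2 ^ (n + 1) - 2) (by omega) (by
    intro t ht h3
    have := Nat.le_of_dvd (by omega) ((hper _).1 h3)
    omega)
  have h3 : wt (star a ((1 + (2 ^ (n + 1) - 2) : ℕ) : Z (n + 1))) ≠ 0 := by
    intro h3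
    have := Nat.le_of_dvd (by omega) ((hper _).1 (wt_eq_zero.1 h3))
    omega
  have h4 := wt_star_lt ha ((1 : ℕ) : Z (n + 1))
  have h5 := wt_lt a
  omega

theorem lt_lv {n : ℕ} {a : Z n} {t : ℕ} (h : lev a ≤ t) (ht : t < n) : t < lv a t := by
  apply Nat.lt_of_succ_le
  rw [lv, le_lev (by omega), ← red_eq_zero (by omega), red_star, map_pow, map_ofNat]
  apply star_two_pow_pred
  rw [Ne, red_eq_zero, ← le_lev (by omega)]
  omega

theorem star_eq_zero_iff {n : ℕ} {a b : Z n} : star a b = 0 ↔ lv a (lev b) = n := by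
  rw [← lev_star, lev_eq_iff]

theorem star_eq_zero_of_dvd {n : ℕ} {a d : Z n} {s : ℕ} (h : lv a s = n) (hd : (2 : Z n) ^ s ∣ d) :
    star a d = 0 := by
  rcases le_total s n with hs | hs
  · rw [star_eq_zero_iff]
    exact le_antisymm (lv_le _ _) (h.ge.trans (lv_mono a ((le_lev hs).2 hd)))
  · rw [two_pow_eq_zero hs, zero_dvd_iff] at hd
    rw [hd, star_zero]

theorem star_congr {n : ℕ} {a b c : Z n} {s : ℕ} (h : lv a s = n) (hd : (2 : Z n) ^ s ∣ b - c) :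
    star a b = star a c := by
  rw [← sub_add_cancel b c, star_add (star_eq_zero_of_dvd h hd)]

theorem lv_red {n m : ℕ} (h : m ≤ n) (a : Z n) (t : ℕ) : lv (red h a) t = min (lv a t) m := by
  rw [lv, lv, ← lev_red h, red_star, map_pow, map_ofNat]

theorem lv_eq_of_le {n : ℕ} {a : Z n} {t t' : ℕ} (h : lv a t = n) (ht : t ≤ t') : lv a t' = n :=
  le_antisymm (lv_le _ _) (h.ge.trans (lv_mono a ht))

/-! ### Joint induction for `Growth` and `Shift` -/

/-- Elements of level below `s` raise the level `s` by at least `2 ^ k`, if `2 ^ k ∣ s`. -/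
def Growth (s : ℕ) : Prop :=
  ∀ n k : ℕ, 2 ^ k ∣ s → ∀ b : Z n, lev b < s → min n (s + 2 ^ k) ≤ lv b s

/-- The element `2 ^ s - 1` maps the level `2 ^ k` to `s + 2 ^ k`, if `2 ^ k ∣ s`. -/
def Shift (s : ℕ) : Prop :=
  ∀ n k : ℕ, 2 ^ k ∣ s → s + 2 ^ k ≤ n → lv (2 ^ s - 1 : Z n) (2 ^ k) = s + 2 ^ k

theorem lv_two_pow_sub_one_zero {n s : ℕ} (hs : s ≤ n) : lv (2 ^ s - 1 : Z n) 0 = s := by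
  rw [lv_zero_right, sub_add_cancel, lev_two_pow hs]

theorem red_two_pow_sub_one {n m : ℕ} (h : m ≤ n) (s : ℕ) :
    red h (2 ^ s - 1) = 2 ^ s - 1 := by
  rw [map_sub, map_pow, map_ofNat, map_one]

theorem lev_neg {n : ℕ} (a : Z n) : lev (-a) = lev a :=
  lev_ext (lev_le _) (lev_le _) fun r hr => by rw [le_lev hr, le_lev hr, dvd_neg]

theorem lev_two_pow_sub_one {n s : ℕ} (hs : 0 < s) (hn : 0 < n) : lev (2 ^ s - 1 : Z n) = 0 := by
  have h1 : lev (1 : Z n) = 0 := by simpa using lev_two_pow (n := n) (t := 0) (Nat.zero_le _)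
  rw [sub_eq_add_neg, lev_add_eq, lev_neg, h1]
  rw [lev_neg, h1]
  rcases le_total s n with h | h
  · rwa [lev_two_pow h]
  · rwa [lev_two_pow_of_le h]

/-- Level 0 goes to s and level 2^k to s+2^k, so strict growth leaves one choice in between. A
larger table is used to keep the cap away. -/
theorem Shift.lv_eq {s : ℕ} (H : Shift s) {n k t : ℕ} (hk : 2 ^ k ∣ s) (ht : t ≤ 2 ^ k)
    (hn : s + t ≤ n) : lv (2 ^ s - 1 : Z n) t = s + t := by
  have hN : n ≤ n + s + 2 ^ k + 1 := by omega
  have h1 := H (n + s + 2 ^ k + 1) k hk (by omega)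
  have h2 := lv_add (2 ^ s - 1 : Z (n + s + 2 ^ k + 1)) 0 t
  have h3 := lv_add (2 ^ s - 1 : Z (n + s + 2 ^ k + 1)) t (2 ^ k - t)
  rw [lv_two_pow_sub_one_zero (by omega), zero_add] at h2
  rw [Nat.add_sub_cancel' ht, h1] at h3
  rw [← red_two_pow_sub_one hN, lv_red]
  omega

/-- With r = s - 2^(j+1), the element 2^r - 1 transports the chain 0 ↦ 2^j ↦ 2^(j+1) of 2^(2^j) - 1
to r ↦ r+2^j ↦ s. -/
theorem exists_link {s n j : ℕ} (H : ∀ s' < s, Shift s') (hs : 0 < s) (hn : s ≤ n)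
    (hj : 2 ^ (j + 1) ∣ s) :
    ∃ c : Z n, lev c = s - 2 ^ (j + 1) ∧ lv c (s - 2 ^ (j + 1)) = s - 2 ^ j ∧
      lv c (s - 2 ^ j) = s := by
  have hle := Nat.le_of_dvd hs hj
  have hpos : 0 < 2 ^ j := by positivity
  have e : 2 ^ (j + 1) = 2 * 2 ^ j := by ring
  set r := s - 2 ^ (j + 1) with hr
  have hr' : s - 2 ^ j = r + 2 ^ j := by omega
  have hr2 : r + 2 ^ (j + 1) = s := by omega
  have hd : 2 ^ (j + 1) ∣ r := Nat.dvd_sub hj dvd_rfl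
  have S1 := H r (by omega)
  have S2 := H (2 ^ j) (by omega)
  have w0 : lv (2 ^ (2 ^ j) - 1 : Z n) 0 = 2 ^ j := lv_two_pow_sub_one_zero (by omega)
  have w1 : lv (2 ^ (2 ^ j) - 1 : Z n) (2 ^ j) = 2 ^ (j + 1) := by
    rw [S2.lv_eq (k := j) dvd_rfl le_rfl (by omega)]; omega
  have r0 : lv (2 ^ r - 1 : Z n) 0 = r := lv_two_pow_sub_one_zero (by omega)
  have r1 : lv (2 ^ r - 1 : Z n) (2 ^ j) = r + 2 ^ j := S1.lv_eq hd (by omega) (by omega)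
  have r2 : lv (2 ^ r - 1 : Z n) (2 ^ (j + 1)) = s := by
    rw [S1.lv_eq hd le_rfl (by omega), hr2]
  refine ⟨star (2 ^ r - 1) (2 ^ (2 ^ j) - 1), ?_, ?_, ?_⟩
  · rw [lev_star, lev_two_pow_sub_one hpos (by omega), r0]
  · have := lv_star (2 ^ r - 1 : Z n) (2 ^ (2 ^ j) - 1) 0
    rw [r0, w0, r1] at this
    rw [this, hr']
  · have := lv_star (2 ^ r - 1 : Z n) (2 ^ (2 ^ j) - 1) (2 ^ j)
    rw [r1, w1, r2] at this
    rw [hr', this]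

theorem exists_crossing {s n k : ℕ} {b : Z n} (hn : s ≤ n) (hb : lev b < s)
    (h : lv b (s - 2 ^ k) < s) :
    ∃ j, j < k ∧ lv b (s - 2 ^ (j + 1)) < s ∧ s ≤ lv b (s - 2 ^ j) := by
  by_contra! hc
  have key : ∀ i, i ≤ k → lv b (s - 2 ^ (k - i)) < s := by
    intro i
    induction i with
    | zero => intro _; simpa using h
    | succ i ih =>
      intro hi
      apply hc _ (by omega)
      rw [show k - (i + 1) + 1 = k - i by omega]
      exact ih (by omega)
  have h1 := key k le_rfl
  rw [Nat.sub_self, pow_zero] at h1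
  have h2 : s - 1 < lv b (s - 1) := lt_lv (by omega) (by omega)
  omega

/-- If the conclusion failed, b would cross s between s - 2^(j+1) and s - 2^j for some j < k, and
the link for that j contradicts `h`. -/
theorem le_lv_of_core {s n k : ℕ} (H : ∀ s' < s, Shift s') (hn : s ≤ n) (hk : 2 ^ k ∣ s)
    {b : Z n} (hb : lev b < s)
    (h : ∀ (c : Z n) (t : ℕ), lv c t = s → lv b (lev c) < s → lv b t < s) :
    s ≤ lv b (s - 2 ^ k) := by
  by_contra! h1
  obtain ⟨j, hj, h2, h3⟩ := exists_crossing hn hb h1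
  obtain ⟨c, c1, -, c3⟩ := exists_link H (by omega) hn ((pow_dvd_pow 2 hj).trans hk)
  have := h c _ c3 (by rwa [c1])
  omega

/-- The element b*c sends `lv b t` to v. If `lv b t` exceeded s, strict growth would make `lv (star
b c) s` smaller than v. -/
theorem lv_le_of_min {s n v : ℕ} (hv : v < n) {b c : Z n} {t : ℕ} (hb : lv b s = v)
    (hmin : v ≤ lv (star b c) s) (hc : lv c t = s) : lv b t ≤ s := by
  by_contra! h1
  have h2 := lv_star b c t
  rw [hc, hb] at h2
  have h3 := lv_mono (star b c) (Nat.succ_le_of_lt h1)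
  rcases lt_or_ge (lv (star b c) s) n with h4 | h4
  · have := lv_lt_succ _ h4; simp only [Nat.succ_eq_add_one] at h3; omega
  · have := lv_mono (star b c) h1.le; omega

/-- Consider the least value v of `lv b s`, and suppose it is below the bound. Multiplying b by a
link at its crossing gives an element with the same v, and minimality forces the crossing to hit s
exactly. Two rounds produce an element of level s - 2^i sending that level to s. Further links lower
the level to s - 2^k (`claim`), and s - 2^k ↦ s would force v ≥ min n (s+2^k). -/
theorem growth_step {s : ℕ} (H : ∀ s' < s, Shift s') : Growth s := by
  intro n k hk
  suffices h : ∀ v, v < min n (s + 2 ^ k) → ∀ b : Z n, lev b < s → lv b s ≠ v by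
    intro b hb
    by_contra! h1
    exact h _ h1 b hb rfl
  intro v
  induction v using Nat.strong_induction_on with
  | _ v ih =>
  intro hv
  have hmin : ∀ b : Z n, lev b < s → v ≤ lv b s := by
    intro b hb
    by_contra! h1
    exact ih _ h1 (by omega) b hb rfl
  have hvn : v < n := by omega
  have hsmall : ∀ b : Z n, lev b < s → lv b s = v → lv b (s - 2 ^ k) < s := by
    intro b hb hbv
    by_contra! h1
    have h2 := lv_add b (s - 2 ^ k) (2 ^ k)
    rw [Nat.sub_add_cancel (Nat.le_of_dvd (by omega) hk), hbv] at h2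
    omega
  have hsn : ∀ b : Z n, lv b s = v → s < n := by
    intro b hbv
    by_contra! h1
    rw [lv_of_le b h1] at hbv; omega
  have claim : ∀ i, i ≤ k → ∀ b : Z n, lev b = s - 2 ^ (k - i) → lev b < s →
      lv b (s - 2 ^ (k - i)) = s → lv b s ≠ v := by
    intro i
    induction i with
    | zero =>
      intro _ b _ hb h1 hbv
      have := hsmall b hb hbv
      rw [Nat.sub_zero] at h1
      omega
    | succ i ihi =>
      intro hi b hlev hb h1 hbv
      set j := k - (i + 1) with hj
      have hji : k - i = j + 1 := by omega
      have hpos : 0 < 2 ^ j := by positivity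
      have e : 2 ^ (j + 1) = 2 * 2 ^ j := by ring
      have hd : 2 ^ (j + 1) ∣ s := (pow_dvd_pow 2 (by omega)).trans hk
      have hle := Nat.le_of_dvd (by omega) hd
      obtain ⟨c, c1, c2, c3⟩ := exists_link H (by omega) (hsn b hbv).le hd
      have f0 : lv b (s - 2 ^ (j + 1)) = s - 2 ^ (j + 1) := lv_of_lt_lev (by omega)
      have f1 : lev (star b c) = s - 2 ^ (j + 1) := by rw [lev_star, c1, f0]
      have f2 := lv_star b c (s - 2 ^ j)
      have f3 := lv_star b c (s - 2 ^ (j + 1))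
      rw [c3, h1, hbv] at f2
      rw [c2, f0, h1] at f3
      rw [hji] at ihi
      exact ihi (by omega) _ f1 (by omega) f3 f2
  intro b hb hbv
  have hs := hsn b hbv
  obtain ⟨j, hj, h2, h3⟩ := exists_crossing hs.le hb (hsmall b hb hbv)
  obtain ⟨c, c1, c2, c3⟩ := exists_link H (by omega) hs.le ((pow_dvd_pow 2 hj).trans hk)
  have l1 : lev (star b c) < s := by rw [lev_star, c1]; exact h2
  have e1 : lv b (s - 2 ^ j) = s := le_antisymm (lv_le_of_min hvn hbv (hmin _ l1) c3) h3
  have f2 := lv_star b c (s - 2 ^ j)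
  have f3 := lv_star b c (s - 2 ^ (j + 1))
  rw [c3, e1, hbv] at f2
  rw [c2, e1] at f3
  have l2 : lev (star b c) = lv b (s - 2 ^ (j + 1)) := by rw [lev_star, c1]
  rw [← l2] at f3
  obtain ⟨i, hi, g2, g3⟩ := exists_crossing hs.le l1 (hsmall _ l1 f2)
  obtain ⟨d, d1, d2, d3⟩ := exists_link H (by omega) hs.le ((pow_dvd_pow 2 hi).trans hk)
  have m1 : lev (star (star b c) d) < s := by rw [lev_star, d1]; exact g2
  have e2 : lv (star b c) (s - 2 ^ i) = s :=
    le_antisymm (lv_le_of_min hvn f2 (hmin _ m1) d3) g3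
  have hlev : lev (star b c) = s - 2 ^ i := by
    rcases lt_trichotomy (lev (star b c)) (s - 2 ^ i) with h | h | h
    · have h5 := lv_lt_succ (star b c) (t := lev (star b c)) (by omega)
      have h6 := lv_mono (star b c) (Nat.succ_le_of_lt h)
      simp only [Nat.succ_eq_add_one] at h6
      omega
    · exact h
    · have := lv_of_lt_lev h
      omega
  have hki : k - (k - i) = i := by omega
  exact claim (k - i) (by omega) _ (by rw [hki, hlev]) l1 (by rw [hki, e2]) f2

theorem lev_natCast_lt {n s i : ℕ} (hs : s ≤ n) (hi : 0 < i) (h : i < 2 ^ s) :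
    lev (i : Z n) < s := by
  by_contra! h1
  have := Nat.le_of_dvd hi ((two_pow_dvd_natCast hs i).1 ((le_lev hs).1 h1))
  omega

theorem lev_add_natCast {n s i : ℕ} (hs : s ≤ n) {a : Z n} (ha : (2 : Z n) ^ s ∣ a) (hi : 0 < i)
    (h : i < 2 ^ s) : lev (a + (i : Z n)) = lev (i : Z n) :=
  lev_add_eq ((lev_natCast_lt hs hi h).trans_le ((le_lev hs).2 ha))

/-- The product a*(i+1) = (a+i)*(a+1) collapses to (a+i)*1 once a+i annihilates a. By `Growth` this
can fail only if n = s+2^k+1, `lev a = s` and a+i sends s to s+2^k. -/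
theorem star_eq_add {s n k : ℕ} (H : ∀ s' < s, Shift s') (G : Growth s) (hk : 2 ^ k ∣ s)
    (hn : n ≤ s + 2 ^ k + 1) {a : Z n} (ha : (2 : Z n) ^ s ∣ a) :
    ∀ i : ℕ, 0 < i → i ≤ 2 ^ s → star a (i : Z n) = a + (i : Z n) := by
  intro i
  induction i with
  | zero => intro h; omega
  | succ i ih =>
    intro _ hi
    rcases Nat.eq_zero_or_pos i with rfl | hi0
    · simp [star_one]
    rcases eq_or_ne a 0 with rfl | ha0
    · simp [star_zero_left]
    have IH := ih hi0 (by omega)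
    have hsn : s ≤ n := by
      by_contra! h1
      rw [two_pow_eq_zero h1.le, zero_dvd_iff] at ha
      exact ha0 ha
    have hla : s ≤ lev a := (le_lev hsn).2 ha
    have hlan : lev a < n := lt_of_le_of_ne (lev_le a) fun h => ha0 (lev_eq_iff.1 h)
    have hs0 : 0 < s := by
      rcases Nat.eq_zero_or_pos s with rfl | h
      · simp at hi; omega
      · exact h
    have hms := Nat.le_of_dvd hs0 hk
    have hm0 : 0 < 2 ^ k := by positivity
    have hb : lev (a + (i : Z n)) < s := by
      rw [lev_add_natCast hsn ha hi0 (by omega)]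
      exact lev_natCast_lt hsn hi0 (by omega)
    have hzero : star (a + (i : Z n)) a = 0 := by
      rw [star_eq_zero_iff]
      by_contra hne
      have h1 : lv (a + (i : Z n)) (lev a) < n := lt_of_le_of_ne (lv_le _ _) hne
      have h2 := lv_mono (a + (i : Z n)) hla
      have h3 := G n k hk _ hb
      have h4 : lv (a + (i : Z n)) s = s + 2 ^ k := by omega
      have h5 : lev a = s := by
        by_contra h5
        have h6 := lv_lt_succ (a + (i : Z n)) (t := s) (by omega)
        have h7 := lv_mono (a + (i : Z n)) (show s + 1 ≤ lev a by omega)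
        omega
      -- Since a+i = a*i, its action on levels below s factors through that of a, which omits s:
      -- lower levels are fixed and s itself moves up.
      have hskip : ∀ t, t < s → lv (a + (i : Z n)) t ≠ s := by
        intro t ht h6
        have h7 := lv_star a (i : Z n) t
        rw [IH, lv_of_lt_lev (a := a) (t := t) (by omega), h6] at h7
        rcases lt_or_ge (lv (i : Z n) t) s with h8 | h8
        · rw [lv_of_lt_lev (by omega)] at h7; omega
        · have h9 := lv_mono a h8
          have h10 := lt_lv (a := a) h5.le (by omega)
          omega
      have hcore := le_lv_of_core H hsn hk hb fun c t hc hlt => by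
        have h6 : lv (a + (i : Z n)) t ≤ s := lv_le_of_min (by omega) h4
          (by have := G n k hk (star (a + (i : Z n)) c) (by rwa [lev_star]); omega) hc
        rcases lt_or_ge t s with h7 | h7
        · exact lt_of_le_of_ne h6 (hskip t h7)
        · have := lv_mono (a + (i : Z n)) h7
          omega
      have h6 := hskip (s - 2 ^ k) (by omega)
      have h7 := lv_add (a + (i : Z n)) (s - 2 ^ k) (2 ^ k)
      rw [Nat.sub_add_cancel hms, h4] at h7
      omega
    push_cast
    rw [star_succ, IH, star_add hzero, star_one, add_assoc]

theorem star_two_pow_sub_one {s n k : ℕ} (H : ∀ s' < s, Shift s') (G : Growth s) (hk : 2 ^ k ∣ s)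
    (hn : n ≤ s + 2 ^ k + 1) (f : Z n) : star (2 ^ s - 1) f = 2 ^ s * f := by
  induction f using Z.induction with
  | h0 => rw [star_zero, mul_zero]
  | hs f ih =>
    have := star_eq_add H G hk hn (Dvd.intro f rfl) (2 ^ s) (by positivity) le_rfl
    push_cast at this
    rw [star_succ, ih, sub_add_cancel, this]; ring

/-- The modulus 2^(s+2^k+1) is within reach of `star_two_pow_sub_one` and just large enough for
2^(s+2^k) to be nonzero, so the level is read off without the cap. -/
theorem shift_step {s : ℕ} (H : ∀ s' < s, Shift s') (G : Growth s) : Shift s := by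
  intro n k hk hn
  have h1 : lv (2 ^ s - 1 : Z (s + 2 ^ k + 1)) (2 ^ k) = s + 2 ^ k := by
    rw [lv, star_two_pow_sub_one H G hk le_rfl, ← pow_add, lev_two_pow (by omega)]
  rcases lt_or_ge (s + 2 ^ k) n with h | h
  · have h2 := lv_red (show s + 2 ^ k + 1 ≤ n by omega) (2 ^ s - 1) (2 ^ k)
    rw [red_two_pow_sub_one, h1] at h2
    omega
  · have h2 := lv_red (show n ≤ s + 2 ^ k + 1 by omega) (2 ^ s - 1) (2 ^ k)
    rw [red_two_pow_sub_one, h1] at h2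
    omega

theorem shift (s : ℕ) : Shift s := by
  induction s using Nat.strong_induction_on with
  | _ s ih => exact shift_step ih (growth_step ih)

theorem growth (s : ℕ) : Growth s := growth_step fun s' _ => shift s'

/-! ### Blocks of 2^s consecutive elements -/

theorem dvd_of_red_eq {n m : ℕ} {x y : Z n} (h : ∀ hm : m ≤ n, red hm x = red hm y)
    (h' : n ≤ m → x = y) : (2 : Z n) ^ m ∣ x - y := by
  rcases le_total m n with hm | hm
  · rw [← red_eq_zero hm, map_sub, h hm, sub_self]
  · rw [h' hm, sub_self]; exact dvd_zero _

theorem dvd_star_sub_add {s n k : ℕ} (hk : 2 ^ k ∣ s) {a : Z n} (ha : (2 : Z n) ^ s ∣ a) {i : ℕ}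
    (hi0 : 0 < i) (hi : i ≤ 2 ^ s) :
    (2 : Z n) ^ (s + 2 ^ k) ∣ star a (i : Z n) - (a + (i : Z n)) := by
  apply dvd_of_red_eq
  · intro hm
    have h1 : (2 : Z (s + 2 ^ k)) ^ s ∣ red hm a := by
      have := map_dvd (red hm) ha
      rwa [map_pow, map_ofNat] at this
    rw [red_star, map_add, map_natCast,
      star_eq_add (fun s' _ => shift s') (growth s) hk (by omega) h1 i hi0 hi]
  · intro hm
    exact star_eq_add (fun s' _ => shift s') (growth s) hk (by omega) ha i hi0 hi

theorem dvd_star_sub_mul {s n k : ℕ} (hk : 2 ^ k ∣ s) (f : Z n) :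
    (2 : Z n) ^ (s + 2 ^ k) ∣ star (2 ^ s - 1) f - 2 ^ s * f := by
  apply dvd_of_red_eq
  · intro hm
    rw [red_star, map_mul, map_pow, map_ofNat, red_two_pow_sub_one,
      star_two_pow_sub_one (fun s' _ => shift s') (growth s) hk (by omega)]
  · intro hm
    exact star_two_pow_sub_one (fun s' _ => shift s') (growth s) hk (by omega) f

/-- The elements `a + i`, `0 < i < 2 ^ s`, annihilate the multiples of `2 ^ s`. -/
def Rows {n : ℕ} (s : ℕ) (a : Z n) : Prop :=
  ∀ i : ℕ, 0 < i → i < 2 ^ s → lv (a + (i : Z n)) s = n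

/-- The products of the values of `y` by the elements `a + i`, `0 < i ≤ 2 ^ s`. -/
def Cols {n : ℕ} (s : ℕ) (a y : Z n) : Prop :=
  ∀ (f : Z n) (i : ℕ), 0 < i → i ≤ 2 ^ s →
    star (star y f) (a + (i : Z n)) = star y (f + 1) - 2 ^ s + (i : Z n)

/-- Here a and y are the first and last elements of an aligned block, and the condition on `lv y`
says that the period of y divides 2^(2^k). -/
def RowShape (s n : ℕ) : Prop :=
  ∀ k : ℕ, 2 ^ k ∣ s → ∀ a y : Z n, y + 1 = a + 2 ^ s → (2 : Z n) ^ s ∣ a →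
    lv y (2 ^ k) = n → Rows s a ∧ Cols s a y

theorem star_natCast_of_zero {n s : ℕ} {a : Z n}
    (h : ∀ i : ℕ, 0 < i → i < 2 ^ s → star (a + (i : Z n)) a = 0) :
    ∀ i : ℕ, 0 < i → i ≤ 2 ^ s → star a (i : Z n) = a + (i : Z n) := by
  intro i
  induction i with
  | zero => intro h; omega
  | succ i ih =>
    intro _ hi
    rcases Nat.eq_zero_or_pos i with rfl | hi0
    · simp [star_one]
    · push_cast
      rw [star_succ, ih hi0 (by omega), star_add (h i hi0 (by omega)), star_one, add_assoc]

theorem Rows.star_natCast {n s : ℕ} {a : Z n} (H : Rows s a) (ha : (2 : Z n) ^ s ∣ a) :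
    ∀ i : ℕ, 0 < i → i ≤ 2 ^ s → star a (i : Z n) = a + (i : Z n) :=
  star_natCast_of_zero fun i h0 h1 => star_eq_zero_of_dvd (H i h0 h1) ha

section

variable {n s : ℕ} {a y : Z n} (hy : y + 1 = a + 2 ^ s)
  (h : ∀ i : ℕ, 0 < i → i ≤ 2 ^ s → star a (i : Z n) = a + (i : Z n))

include hy h

theorem eq_comp_of_star : y = star a (2 ^ s - 1 + 1) - 1 := by
  have := h (2 ^ s) (by positivity) le_rfl
  push_cast at this
  rw [sub_add_cancel, this, ← hy, add_sub_cancel_right]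

theorem star_top (f : Z n) : star y f = star a (star (2 ^ s - 1) f) := by
  rw [eq_comp_of_star hy h, star_comp]

theorem lv_top (t : ℕ) : lv y t = lv a (lv (2 ^ s - 1 : Z n) t) := by
  rw [eq_comp_of_star hy h, lv_comp]

theorem lv_base_eq {k : ℕ} (hk : 2 ^ k ∣ s) (hl : lv y (2 ^ k) = n) : lv a (s + 2 ^ k) = n := by
  rcases le_total (s + 2 ^ k) n with h1 | h1
  · have h2 := lv_top hy h (2 ^ k)
    rw [(shift s).lv_eq hk le_rfl h1, hl] at h2
    exact h2.symm
  · exact lv_of_le a h1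

end

theorem lv_comp_eq {n t : ℕ} {y : Z n} (h : lv y t = n) (f : Z n) :
    lv (star y (f + 1) - 1) t = n := by
  rw [lv_comp]
  rcases le_total t n with h1 | h1
  · exact lv_eq_of_le h (le_lv f h1)
  · rw [lv_of_le f h1, lv_of_le y le_rfl]

theorem lv_zero_right_le {n : ℕ} (y f : Z n) : lev (y + 1) ≤ lev (star y f) := by
  rw [lev_star, ← lv_zero_right]
  exact lv_mono y (Nat.zero_le _)

theorem dvd_star_of_dvd {n s : ℕ} {y : Z n} (h : (2 : Z n) ^ s ∣ y + 1) (f : Z n) :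
    (2 : Z n) ^ s ∣ star y f := by
  rcases le_total s n with hs | hs
  · exact (le_lev hs).1 (((le_lev hs).2 h).trans (lv_zero_right_le y f))
  · rw [two_pow_eq_zero hs, zero_dvd_iff] at h ⊢
    rw [← lev_eq_iff]
    have := lv_zero_right_le y f
    rw [h, lev_zero] at this
    exact le_antisymm (lev_le _) this

theorem lev_add_two_pow {n s : ℕ} {a : Z n} (h : lev a = s) (hs : s < n) :
    s < lev (a + 2 ^ s) := by
  apply Nat.lt_of_succ_le
  have h2 : red hs.le (a) = 0 := (red_eq_zero _ _).2 ((le_lev hs.le).1 h.ge)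
  rw [← red_red (Nat.succ_le_of_lt hs) s.le_succ] at h2
  rw [le_lev hs, ← red_eq_zero hs]
  rcases eq_zero_or_of_red h2 with h3 | h3
  · rw [red_eq_zero, ← le_lev hs] at h3
    simp only [Nat.succ_eq_add_one] at h3; omega
  · rw [map_add, h3, map_pow, map_ofNat, ← two_mul, ← pow_succ', two_pow_self]

/-- Descend from i = 2^s, where a+2^s = y*1 and distributivity gives (y*f)*(y*1) = y*(f+1). -/
theorem cols_of_step {n s θ : ℕ} {a y : Z n} (hy : y + 1 = a + 2 ^ s) (f : Z n)
    (h : ∀ i : ℕ, θ < i → i < 2 ^ s →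
      star (star y f) (a + ((i + 1 : ℕ) : Z n)) = star (star y f) (a + (i : Z n)) + 1) :
    ∀ i : ℕ, θ < i → i ≤ 2 ^ s →
      star (star y f) (a + (i : Z n)) = star y (f + 1) - 2 ^ s + (i : Z n) := by
  intro i hi hi'
  obtain ⟨d, hd⟩ := Nat.exists_eq_add_of_le hi'
  induction d generalizing i with
  | zero =>
    rw [add_zero] at hd
    have h1 : (i : Z n) = 2 ^ s := by rw [← hd]; push_cast; rfl
    rw [h1, ← hy, ← star_one y, ← star_distrib, star_one]; ring
  | succ d ih =>
    have h1 := h i hi (by omega)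
    rw [ih (i + 1) (by omega) (by omega) (by omega)] at h1
    push_cast at h1
    rw [← add_right_cancel_iff (a := (1 : Z n)), ← h1]; ring

/-- Here y*f has level above s, hence fixes level s and transports the annihilation of s from a+i to
(y*f)*(a+i), which then annihilates y*f. -/
theorem cols_of_lev_eq {n s θ : ℕ} {a y : Z n} (hy : y + 1 = a + 2 ^ s) (hs : s < n)
    (ha : lev a = s) (h : ∀ i : ℕ, θ < i → i < 2 ^ s → lv (a + (i : Z n)) s = n) (f : Z n) :
    ∀ i : ℕ, θ < i → i ≤ 2 ^ s →
      star (star y f) (a + (i : Z n)) = star y (f + 1) - 2 ^ s + (i : Z n) := by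
  refine cols_of_step hy f fun i hi hi' => ?_
  have h1 : s < lev (star y f) :=
    (lev_add_two_pow ha hs).trans_le (hy ▸ lv_zero_right_le y f)
  have h2 := lv_star (star y f) (a + (i : Z n)) s
  rw [h i hi hi', lv_of_lt_lev h1, lv_of_le _ le_rfl] at h2
  push_cast
  rw [← add_assoc, star_succ, star_add, star_one]
  exact star_eq_zero_of_dvd h2 ((le_lev hs.le).1 h1.le)

/-- As 2^(s+1) divides a, an element annihilates a as soon as it annihilates level s modulo 2^n,
since strict growth supplies the last factor 2. So the smaller table decides everything. -/
theorem cols_of_lt_lev {n s k : ℕ} {a y : Z (n + 1)} (IH : RowShape s n) (hk : 2 ^ k ∣ s)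
    (hy : y + 1 = a + 2 ^ s) (ha : s < lev a) (hl : lv y (2 ^ k) = n + 1) :
    Cols s a y := by
  have hsn : s ≤ n := by have := lev_le a; omega
  have hsn' : s ≤ n + 1 := by omega
  have had : (2 : Z (n + 1)) ^ (s + 1) ∣ a := (le_lev (by omega)).1 ha
  have had' : (2 : Z (n + 1)) ^ s ∣ a := (pow_dvd_pow 2 s.le_succ).trans had
  have hyr : red n.le_succ y + 1 = red n.le_succ a + 2 ^ s := by
    have := congrArg (red n.le_succ) hy
    rwa [map_add, map_add, map_pow, map_ofNat, map_one] at this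
  have hadr : (2 : Z n) ^ s ∣ red n.le_succ a := by
    have := map_dvd (red n.le_succ) had'
    rwa [map_pow, map_ofNat] at this
  have hlr : lv (red n.le_succ y) (2 ^ k) = n := by rw [lv_red, hl]; omega
  obtain ⟨R, C⟩ := IH k hk _ _ hyr hadr hlr
  have up : ∀ x : Z (n + 1), lv (red n.le_succ x) s = n → star x a = 0 := by
    intro x hx
    rw [lv_red] at hx
    refine star_eq_zero_of_dvd (s := s + 1) ?_ had
    have := lv_le x (s + 1)
    have := lv_le x s
    rcases lt_or_ge (lv x s) (n + 1) with h1 | h1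
    · have := lv_lt_succ x h1; omega
    · have := lv_mono x (show s ≤ s + 1 by omega); omega
  have hstar := star_natCast_of_zero (s := s) (a := a) fun i h0 h1 => up _ (by
    rw [map_add, map_natCast]; exact R i h0 h1)
  have hper := lv_base_eq hy hstar hk hl
  intro f i hi hi'
  refine cols_of_step (θ := 0) hy f (fun i hi hi' => ?_) i hi hi'
  have hε : (2 : Z (n + 1)) ^ s ∣ star (2 ^ s - 1) f :=
    dvd_star_of_dvd (by rw [sub_add_cancel]) f
  have hv : ∀ i : ℕ, 0 < i → i ≤ 2 ^ s → star (star y f) (a + (i : Z (n + 1))) =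
      star a (star (2 ^ s - 1) f + (i : Z (n + 1))) := by
    intro i h0 h1
    rw [star_top hy hstar, ← hstar i h0 h1, ← star_distrib]
    exact star_congr hper (dvd_star_sub_add hk hε h0 h1)
  rw [hv (i + 1) (by omega) (by omega)]
  push_cast
  rw [← add_assoc, star_succ, ← hv i hi hi'.le, star_add, star_one]
  apply up
  rw [red_star, red_star, map_add, map_natCast, C _ i hi hi'.le]
  refine (IH k hk (star (red n.le_succ y) (red n.le_succ f + 1) - 2 ^ s)
    (star (red n.le_succ y) (red n.le_succ f + 1) - 1) (by ring) ?_ (lv_comp_eq hlr _)).1 i hi hi'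
  exact dvd_sub (dvd_star_of_dvd (hyr ▸ dvd_add hadr dvd_rfl) _) dvd_rfl

/-- Every element is of the form `2 ^ s * f + i` with `0 < i ≤ 2 ^ s`. -/
theorem exists_eq_mul_add {n : ℕ} (s : ℕ) (z : Z n) :
    ∃ (f : Z n) (i : ℕ), 0 < i ∧ i ≤ 2 ^ s ∧ z = 2 ^ s * f + (i : Z n) := by
  have hpos : 0 < 2 ^ s := by positivity
  refine ⟨((((z - 1).val / 2 ^ s : ℕ)) : Z n), (z - 1).val % 2 ^ s + 1, by omega,
    Nat.mod_lt _ hpos, ?_⟩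
  have h1 : (((2 ^ s * ((z - 1).val / 2 ^ s) + (z - 1).val % 2 ^ s : ℕ)) : Z n) = z - 1 := by
    rw [Nat.div_add_mod, ZMod.natCast_zmod_val]
  push_cast at h1 ⊢
  rw [← add_assoc, h1, sub_add_cancel]

/-- The expected set of values of the rows of `a + i`, `0 ≤ i < 2 ^ s`. -/
def Vals {n : ℕ} (s : ℕ) (y : Z n) : Set (Z n) :=
  {w | ∃ (f : Z n) (i : ℕ), 0 < i ∧ i ≤ 2 ^ s ∧ w = star y (f + 1) - 2 ^ s + (i : Z n)}

theorem star_mem_vals {n : ℕ} (s : ℕ) (y z : Z n) : star y z ∈ Vals s y :=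
  ⟨z - 1, 2 ^ s, by positivity, le_rfl, by push_cast; simp⟩

theorem vals_comp_subset {n : ℕ} (s : ℕ) (y f : Z n) : Vals s (star y (f + 1) - 1) ⊆ Vals s y := by
  rintro w ⟨g, i, h0, h1, rfl⟩
  exact ⟨star f (g + 1) - 1, i, h0, h1, by rw [star_comp, sub_add_cancel]⟩

section

variable {n s k : ℕ} {a y : Z n} (hk : 2 ^ k ∣ s) (hy : y + 1 = a + 2 ^ s)
  (ha : (2 : Z n) ^ s ∣ a) (hl : lv y (2 ^ k) = n) (R : Rows s a) (C : Cols s a y)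

include hk hy ha hl R C

/-- Since a ignores multiples of 2^(s+2^k), the arguments 2^s f + i and (2^s f)*i are
interchangeable, as are 2^s f and (2^s-1)*f. Distributivity and y = a∘(2^s-1) then reduce the claim
to `Cols`. -/
theorem star_base (f : Z n) {i : ℕ} (hi : 0 < i) (hi' : i ≤ 2 ^ s) :
    star a (2 ^ s * f + (i : Z n)) = star y (f + 1) - 2 ^ s + (i : Z n) := by
  have hstar := R.star_natCast ha
  have hper := lv_base_eq hy hstar hk hl
  rw [← C f i hi hi', star_top hy hstar, ← hstar i hi hi',
    star_congr hper (dvd_star_sub_mul hk f), ← star_distrib]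
  exact (star_congr hper (dvd_star_sub_add hk (Dvd.intro f rfl) hi hi')).symm

theorem star_base_mem_vals (z : Z n) : star a z ∈ Vals s y := by
  obtain ⟨f, i, h0, h1, rfl⟩ := exists_eq_mul_add s z
  exact ⟨f, i, h0, h1, star_base hk hy ha hl R C f h0 h1⟩

theorem star_base_add_mem_vals {i : ℕ} (hi : 0 < i) (hi' : i < 2 ^ s) (z : Z n) :
    star (a + (i : Z n)) z ∈ Vals s y := by
  have hstar := R.star_natCast ha
  obtain ⟨f, j, h0, h1, rfl⟩ := exists_eq_mul_add s z
  have h2 : star (a + (i : Z n)) (2 ^ s * f + (j : Z n)) = star (a + (i : Z n)) (a + (j : Z n)) :=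
    star_congr (R i hi hi') (by
      rw [add_sub_add_right_eq_sub]; exact dvd_sub (Dvd.intro f rfl) ha)
  rw [h2, ← hstar i hi hi'.le, ← hstar j h0 h1, ← star_distrib]
  exact star_base_mem_vals hk hy ha hl R C _

end

/-! ### The induction for `RowShape` -/

theorem wt_injective {n : ℕ} : Function.Injective (wt : Z n → ℕ) := fun _ _ h =>
  neg_injective (ZMod.val_injective _ h)

theorem wt_add_natCast {n i : ℕ} {a : Z n} (h : i ≤ wt a) : wt (a + (i : Z n)) = wt a - i := by
  have h1 : -(a + (i : Z n)) = ((wt a - i : ℕ) : Z n) := by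
    rw [Nat.cast_sub h, wt, ZMod.natCast_zmod_val]; ring
  rw [wt, h1, ZMod.val_natCast_of_lt]
  have := wt_lt a
  omega

theorem wt_sub_one_le {n : ℕ} (a : Z n) : wt (a - 1) ≤ wt a + 1 := by
  have h1 : -(a - 1) = ((wt a + 1 : ℕ) : Z n) := by
    push_cast; rw [wt, ZMod.natCast_zmod_val]; ring
  rw [wt, h1, ZMod.val_natCast]
  exact Nat.mod_le _ _

theorem two_pow_le_wt {n s : ℕ} (hs : s ≤ n) {a : Z n} (ha : (2 : Z n) ^ s ∣ a) (h : a ≠ 0) :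
    2 ^ s ≤ wt a := by
  refine Nat.le_of_dvd (Nat.pos_of_ne_zero fun h1 => h (wt_eq_zero.1 h1)) ?_
  rw [← two_pow_dvd_natCast hs, wt, ZMod.natCast_zmod_val, dvd_neg]
  exact ha

theorem lev_vals {n s i : ℕ} (hs : s ≤ n) {y f : Z n} (hy : (2 : Z n) ^ s ∣ y + 1) (hi' : i ≤ 2 ^ s)
    (h : lev (star y (f + 1) - 2 ^ s + (i : Z n)) < s) : i < 2 ^ s := by
  refine lt_of_le_of_ne hi' fun h1 => ?_
  have h2 : (i : Z n) = 2 ^ s := by rw [h1]; push_cast; rfl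
  rw [h2, sub_add_cancel] at h
  have := (le_lev hs).2 (dvd_star_of_dvd hy (f + 1))
  omega

section

variable {n s k θ : ℕ} {a y : Z n}

/-- The induction step for the rows of `a + θ`. -/
theorem star_mem_vals_step (hk : 2 ^ k ∣ s) (hy : y + 1 = a + 2 ^ s)
    (ha : (2 : Z n) ^ s ∣ a) (hl : lv y (2 ^ k) = n) (hwa : 2 ^ s ≤ wt a)
    (IHy : ∀ f : Z n, star y (f + 1) - 1 ≠ y →
      Rows s (star y (f + 1) - 2 ^ s) ∧
        Cols s (star y (f + 1) - 2 ^ s) (star y (f + 1) - 1))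
    (hθ : θ + 1 < 2 ^ s)
    (D : ∀ i : ℕ, θ < i → i < 2 ^ s → ∀ z, star (a + (i : Z n)) z ∈ Vals s y)
    (C : ∀ (f : Z n) (i : ℕ), θ < i → i ≤ 2 ^ s →
      star (star y f) (a + (i : Z n)) = star y (f + 1) - 2 ^ s + (i : Z n)) (z : Z n) :
    star (a + (θ : Z n)) z ∈ Vals s y := by
  induction z using Z.induction with
  | h0 => rw [star_zero, ← star_zero y]; exact star_mem_vals s y 0
  | hs z ih =>
    obtain ⟨f, i, hi0, hi, hw⟩ := ih
    have hya : (2 : Z n) ^ s ∣ y + 1 := hy ▸ dvd_add ha dvd_rfl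
    rw [star_succ]
    rcases Nat.lt_or_ge i (2 ^ s) with hi' | hi'
    · by_cases hf : star y (f + 1) - 1 = y
      · have e : star y (f + 1) - 2 ^ s = a := by
          rw [sub_eq_iff_eq_add.1 hf, hy, add_sub_cancel_right]
        rw [e] at hw
        have hb : a + (θ : Z n) ≠ 0 := by
          intro h0
          have := wt_add_natCast (a := a) (i := θ) (by omega)
          rw [wt_eq_zero.2 h0] at this
          omega
        -- The value stays in the same block, so the drop in weight forces i > θ, a row already
        -- treated.
        have h1 := wt_star_lt hb z
        rw [hw, wt_add_natCast (by omega), wt_add_natCast (by omega)] at h1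
        rw [hw]
        exact D i (by omega) hi' _
      · obtain ⟨R', C'⟩ := IHy f hf
        rw [hw]
        exact vals_comp_subset s y f (star_base_add_mem_vals hk (by ring)
          (dvd_sub (dvd_star_of_dvd hya _) dvd_rfl) (lv_comp_eq hl f) R' C' hi0 hi' _)
    · have h2 : (i : Z n) = 2 ^ s := by rw [le_antisymm hi hi']; push_cast; rfl
      rw [hw, h2, sub_add_cancel]
      have h3 := C (f + 1) (θ + 1) (by omega) (by omega)
      push_cast at h3
      rw [add_assoc, h3]
      exact ⟨f + 1, θ + 1, by omega, by omega, by push_cast; rfl⟩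

theorem lv_star_eq_of_mem_vals (hs : s ≤ n) (hy : y + 1 = a + 2 ^ s) (ha : (2 : Z n) ^ s ∣ a)
    (hwa : 2 ^ s ≤ wt a)
    (IHy : ∀ f : Z n, star y (f + 1) - 1 ≠ y → Rows s (star y (f + 1) - 2 ^ s))
    (D : ∀ i : ℕ, θ < i → i < 2 ^ s → lv (a + (i : Z n)) s = n) {j : ℕ} (hj : θ ≤ j)
    (hj' : j < 2 ^ s) {c : Z n} (hc : star (a + (j : Z n)) c ∈ Vals s y)
    (hlev : lev (star (a + (j : Z n)) c) < s) : lv (star (a + (j : Z n)) c) s = n := by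
  obtain ⟨f, i, hi0, hi, hw⟩ := hc
  have hya : (2 : Z n) ^ s ∣ y + 1 := hy ▸ dvd_add ha dvd_rfl
  have hi' : i < 2 ^ s := lev_vals hs hya hi (hw ▸ hlev)
  by_cases hf : star y (f + 1) - 1 = y
  · have e : star y (f + 1) - 2 ^ s = a := by
      rw [sub_eq_iff_eq_add.1 hf, hy, add_sub_cancel_right]
    rw [e] at hw
    have hb : a + (j : Z n) ≠ 0 := by
      intro h0
      have := wt_add_natCast (a := a) (i := j) (by omega)
      rw [wt_eq_zero.2 h0] at this
      omega
    have h1 := wt_star_lt hb c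
    rw [hw, wt_add_natCast (by omega), wt_add_natCast (by omega)] at h1
    rw [hw]
    exact D i (by omega) hi'
  · rw [hw]
    exact IHy f hf i hi0 hi'

end

/-- If a+θ fails, `le_lv_of_core` makes it send r = s - 2^k to at least s. Cut the block into
sub-blocks of size 2^r and use `RowShape r`, available with the doubled bound 2^(k+1). If a+θ starts
a sub-block, that sub-block must be the last one, with top y. Otherwise a+θ lies inside a sub-block,
whose top is shown to have a short enough period. -/
theorem lv_row_step {n s k θ : ℕ} {a y : Z n} (IHs : ∀ s' < s, 0 < s' → RowShape s' n)
    (hs0 : 0 < s) (hk : 2 ^ k ∣ s) (hk' : 2 ^ (k + 1) ∣ s - 2 ^ k) (hn : s + 2 ^ k < n)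
    (hy : y + 1 = a + 2 ^ s)
    (ha : (2 : Z n) ^ s ∣ a) (hl : lv y (2 ^ k) = n) (hθ0 : 0 < θ) (hθ : θ + 1 < 2 ^ s)
    (G : ∀ j : ℕ, θ ≤ j → j + 1 < 2 ^ s → ∀ c, lev (star (a + (j : Z n)) c) < s →
      lv (star (a + (j : Z n)) c) s = n) :
    lv (a + (θ : Z n)) s = n := by
  by_contra hne
  have hlt : lv (a + (θ : Z n)) s < n := lt_of_le_of_ne (lv_le _ _) hne
  have hms := Nat.le_of_dvd hs0 hk
  have hm0 : 0 < 2 ^ k := by positivity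
  have e2 : 2 ^ (k + 1) = 2 * 2 ^ k := by ring
  have hlev : ∀ j : ℕ, 0 < j → j < 2 ^ s → lev (a + (j : Z n)) < s := fun j h0 h1 => by
    rw [lev_add_natCast (by omega) ha h0 h1]
    exact lev_natCast_lt (by omega) h0 h1
  have hcore : s ≤ lv (a + (θ : Z n)) (s - 2 ^ k) := by
    refine le_lv_of_core (fun s' _ => shift s') (by omega) hk (hlev θ hθ0 (by omega))
      fun c t hc hlt' => ?_
    by_contra! h1
    have h2 := lv_star (a + (θ : Z n)) c t
    have h3 := lv_eq_of_le (G θ le_rfl hθ c (by rwa [lev_star])) h1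
    rw [h3, hc] at h2
    omega
  rcases Nat.eq_zero_or_pos (s - 2 ^ k) with h0 | hr0
  · rw [h0, lv_zero_right] at hcore
    have := hlev (θ + 1) (by omega) hθ
    push_cast at this
    rw [← add_assoc] at this
    omega
  set r := s - 2 ^ k with hr
  have hrs : r + 2 ^ k = s := by omega
  have hpr : 0 < 2 ^ r := by positivity
  have hps : 2 ^ s = 2 ^ r * 2 ^ (2 ^ k) := by rw [← pow_add, hrs]
  have IHr := IHs r (by omega) hr0 (k + 1) hk'
  have har : (2 : Z n) ^ r ∣ a := (pow_dvd_pow 2 (by omega)).trans ha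
  have hdm := Nat.div_add_mod θ (2 ^ r)
  have hmod := Nat.mod_lt θ hpr
  set u := θ / 2 ^ r with hu
  have hu' : 2 ^ r * (u + 1) ≤ 2 ^ s := by
    rw [hps]
    refine Nat.mul_le_mul_left _ (Nat.succ_le_of_lt ?_)
    rw [hu]
    exact Nat.div_lt_of_lt_mul (by rw [← hps]; omega)
  have hl2 : lv y (2 ^ (k + 1)) = n := lv_eq_of_le hl (by omega)
  rw [mul_add, mul_one] at hu'
  rcases Nat.eq_zero_or_pos (θ % 2 ^ r) with hz | hz
  · rw [hz, add_zero] at hdm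
    have hbr : (2 : Z n) ^ r ∣ a + (θ : Z n) := by
      refine dvd_add har ?_
      rw [← hdm]; push_cast; exact Dvd.intro _ rfl
    have h1 : (2 : Z n) ^ s ∣ a + (θ : Z n) + 2 ^ r := by
      have h2 : (2 : Z n) ^ s ∣ star (a + (θ : Z n)) (2 ^ r) := (le_lev (by omega)).1 hcore
      have h3 := dvd_star_sub_add hk' hbr (i := 2 ^ r) hpr le_rfl
      push_cast at h3
      have h4 := dvd_sub h2 ((pow_dvd_pow 2 (by omega)).trans h3)
      rwa [sub_sub_cancel] at h4
    have h2 : θ + 2 ^ r = 2 ^ s := by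
      by_contra h3
      have h4 := hlev (θ + 2 ^ r) (by omega) (by omega)
      push_cast at h4
      rw [← add_assoc] at h4
      have := (le_lev (show s ≤ n by omega)).2 h1
      omega
    have hyb : y + 1 = a + (θ : Z n) + 2 ^ r := by
      have : ((θ + 2 ^ r : ℕ) : Z n) = ((2 ^ s : ℕ) : Z n) := by rw [h2]
      push_cast at this
      rw [hy, ← this, add_assoc]
    obtain ⟨R, -⟩ := IHr (a + (θ : Z n)) y hyb hbr hl2
    have h3 := lv_top hyb (R.star_natCast hbr) (2 ^ k)
    rw [(shift r).lv_eq hk' (by omega) (by omega), hl, hrs] at h3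
    exact hne h3.symm
  · set x := 2 ^ r * u with hx
    set y' : Z n := a + ((x + (2 ^ r - 1) : ℕ) : Z n) with hy'
    have hy1 : y' + 1 = a + (x : Z n) + 2 ^ r := by
      rw [hy']; push_cast [Nat.cast_sub (Nat.one_le_two_pow (n := r))]; ring
    have hbr : (2 : Z n) ^ r ∣ a + (x : Z n) := by
      refine dvd_add har ?_
      rw [hx]; push_cast; exact Dvd.intro _ rfl
    have hly : lv y' (2 ^ (k + 1)) = n := by
      rcases eq_or_lt_of_le hu' with h1 | h1
      · have : y' = y := by
          have h2 : ((x + 2 ^ r : ℕ) : Z n) = ((2 ^ s : ℕ) : Z n) := by rw [h1]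
          push_cast at h2
          rw [← add_right_cancel_iff (a := (1 : Z n)), hy1, hy, ← h2, add_assoc]
        rw [this, hl2]
      · have h2 : lev (2 ^ (2 ^ k) - 1 : Z n) = 0 := lev_two_pow_sub_one hm0 (by omega)
        have h3 : lev (star y' (2 ^ (2 ^ k) - 1)) < s := by
          rw [lev_star, h2, lv_zero_right, hy1]
          have := hlev (x + 2 ^ r) (by omega) h1
          push_cast at this
          rwa [← add_assoc] at this
        -- Multiplying y' by 2^(2^k) - 1, which sends 2^k to 2^(k+1), turns annihilation of s by the
        -- product into annihilation of 2^(k+1) by y'.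
        have h4 := G (x + (2 ^ r - 1)) (by omega) (by omega) _ h3
        have h5 := lv_star y' (2 ^ (2 ^ k) - 1) (2 ^ k)
        rw [(shift (2 ^ k)).lv_eq (k := k) dvd_rfl le_rfl (by omega), ← two_mul, ← e2] at h5
        rw [← h5]
        refine lv_eq_of_le h4 ?_
        have h6 := lv_add y' 0 (2 ^ k)
        have h7 : r ≤ lv y' 0 := by
          rw [lv_zero_right, le_lev (by omega), hy1]
          exact dvd_add hbr dvd_rfl
        rw [zero_add] at h6
        omega
    obtain ⟨R, -⟩ := IHr (a + (x : Z n)) y' hy1 hbr hly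
    have h1 := R (θ % 2 ^ r) hz hmod
    rw [add_assoc, ← Nat.cast_add, hdm] at h1
    exact hne (lv_eq_of_le h1 (by omega))

theorem exists_max_pow {s k : ℕ} (hs : 0 < s) (hk : 2 ^ k ∣ s) :
    ∃ l, k ≤ l ∧ 2 ^ l ∣ s ∧ 2 ^ (l + 1) ∣ s - 2 ^ l := by
  obtain ⟨l, m, hm, rfl⟩ := Nat.exists_eq_two_pow_mul_odd hs.ne'
  refine ⟨l, ?_, Dvd.intro _ rfl, ?_⟩
  · have h1 : Nat.Coprime (2 ^ k) m := Nat.Coprime.pow_left _ (Nat.coprime_two_left.2 hm)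
    exact (Nat.pow_dvd_pow_iff_le_right (by norm_num)).1 (h1.dvd_of_dvd_mul_right hk)
  · obtain ⟨t, rfl⟩ := hm
    refine ⟨t, ?_⟩
    rw [mul_add, mul_one, Nat.add_sub_cancel]; ring

/-- Rows are treated from the top of the block downwards. Each value in such a row lies in the block
ending at some y*(f+1)-1. That block either has a top of smaller weight than y, or is the given
block, entered at a later position. -/
theorem rowShape {s : ℕ} (hs0 : 0 < s) (n : ℕ) : RowShape s n := by
  induction s using Nat.strong_induction_on generalizing n with
  | _ s IHs =>
  induction n with
  | zero =>
    have : Subsingleton (Z 0) := inferInstanceAs (Subsingleton (ZMod 1))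
    exact fun k _ a y _ _ _ =>
      ⟨fun i _ _ => lv_of_le _ (Nat.zero_le _), fun f i _ _ => Subsingleton.elim _ _⟩
  | succ n IHn =>
  intro k' hk' a y
  induction hw : wt y using Nat.strong_induction_on generalizing a y with
  | _ w IHy =>
  intro hy ha hl'
  -- The hypothesis weakens as k grows, so k may be the full exponent of 2 in s; then 2^(k+1)
  -- divides s - 2^k, as `lv_row_step` requires.
  obtain ⟨k, hkk, hk, hkd⟩ := exists_max_pow hs0 hk'
  have hl : lv y (2 ^ k) = n + 1 := lv_eq_of_le hl' (Nat.pow_le_pow_right (by norm_num) hkk)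
  have hya : (2 : Z (n + 1)) ^ s ∣ y + 1 := hy ▸ dvd_add ha dvd_rfl
  have hms := Nat.le_of_dvd hs0 hk
  -- The columns follow from the rows.
  have cols : s ≤ n → ∀ θ, (∀ i : ℕ, θ < i → i < 2 ^ s → lv (a + (i : Z (n + 1))) s = n + 1) →
      ∀ (f : Z (n + 1)) (i : ℕ), θ < i → i ≤ 2 ^ s →
        star (star y f) (a + (i : Z (n + 1))) = star y (f + 1) - 2 ^ s + (i : Z (n + 1)) := by
    intro hsn θ hD f i hi hi'
    rcases eq_or_lt_of_le ((le_lev (show s ≤ n + 1 by omega)).2 ha) with h | h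
    · exact cols_of_lev_eq hy (by omega) h.symm hD f i hi hi'
    · exact cols_of_lt_lev IHn hk hy h hl f i (by omega) hi'
  suffices rows : Rows s a by
    refine ⟨rows, ?_⟩
    rcases Nat.lt_or_ge n s with h | h
    · intro f i hi hi'
      have h2 : (2 : Z (n + 1)) ^ s = 0 := two_pow_eq_zero h
      rw [h2, zero_dvd_iff] at ha
      rw [h2, ha, add_zero] at hy
      have h3 : star y (f + 1) = 0 := by
        rw [← zero_dvd_iff, ← h2]; exact dvd_star_of_dvd hya _
      have h4 : star y f = 0 := by
        rw [← zero_dvd_iff, ← h2]; exact dvd_star_of_dvd hya _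
      rw [h3, h4, h2, ha, star_zero_left, sub_zero]
    · exact cols h 0 fun i h0 h1 => rows i h0 h1
  rcases Nat.lt_or_ge (s + 2 ^ k) (n + 1) with hn | hn
  swap
  -- In a table this small, `growth` alone already reaches the cap.
  · intro i h0 h1
    rcases le_total s (n + 1) with hs | hs
    · have := growth s (n + 1) k hk (a + (i : Z (n + 1))) (by
        rw [lev_add_natCast hs ha h0 h1]; exact lev_natCast_lt hs h0 h1)
      have := lv_le (a + (i : Z (n + 1))) s
      omega
    · exact lv_of_le _ hs
  -- For a = 0 the top is 2^s - 1, whose period is too long by `shift`. With a nonzero, the block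
  -- does not wrap past 0 and weights fall by one along it.
  have ha0 : a ≠ 0 := by
    rintro rfl
    rw [zero_add] at hy
    rw [eq_sub_of_add_eq hy, (shift s).lv_eq hk le_rfl hn.le] at hl
    omega
  have hwa := two_pow_le_wt (show s ≤ n + 1 by omega) ha ha0
  have hytop : a + ((2 ^ s - 1 : ℕ) : Z (n + 1)) = y := by
    rw [Nat.cast_sub Nat.one_le_two_pow]; push_cast
    rw [← add_sub_assoc, ← hy, add_sub_cancel_right]
  have hp1 : 1 ≤ 2 ^ s := Nat.one_le_two_pow
  have hwy : wt y = wt a - (2 ^ s - 1) := by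
    rw [← hytop, wt_add_natCast (by omega)]
  have hy0 : y ≠ 0 := fun h => by rw [wt_eq_zero.2 h] at hwy; omega
  have IHf : ∀ f : Z (n + 1), star y (f + 1) - 1 ≠ y →
      Rows s (star y (f + 1) - 2 ^ s) ∧
        Cols s (star y (f + 1) - 2 ^ s) (star y (f + 1) - 1) := by
    intro f hf
    have h1 := wt_star_lt hy0 (f + 1)
    have h2 := wt_sub_one_le (star y (f + 1))
    have h3 : wt (star y (f + 1) - 1) ≠ wt y := fun h => hf (wt_injective h)
    exact IHy _ (by omega) _ _ rfl (by ring) (dvd_sub (dvd_star_of_dvd hya _) dvd_rfl)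
      (lv_comp_eq hl' f)
  have key : ∀ d i : ℕ, 0 < i → i + d + 1 = 2 ^ s →
      lv (a + (i : Z (n + 1))) s = n + 1 ∧ ∀ z, star (a + (i : Z (n + 1))) z ∈ Vals s y := by
    intro d
    induction d using Nat.strong_induction_on with
    | _ d IHd =>
    intro i hi hid
    rcases Nat.eq_zero_or_pos d with rfl | hd
    · have : i = 2 ^ s - 1 := by omega
      rw [this, hytop]
      exact ⟨lv_eq_of_le hl hms, fun z => star_mem_vals s y z⟩
    · have D : ∀ j : ℕ, i < j → j < 2 ^ s →
          lv (a + (j : Z (n + 1))) s = n + 1 ∧ ∀ z, star (a + (j : Z (n + 1))) z ∈ Vals s y :=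
        fun j h0 h1 => IHd (2 ^ s - 1 - j) (by omega) j (by omega) (by omega)
      have hC := cols (by omega) i fun j h0 h1 => (D j h0 h1).1
      have hV : ∀ z, star (a + (i : Z (n + 1))) z ∈ Vals s y :=
        star_mem_vals_step hk hy ha hl hwa IHf (by omega)
          (fun j h0 h1 => (D j h0 h1).2) hC
      refine ⟨?_, hV⟩
      refine lv_row_step (fun s' h0 h1 => IHs s' h0 h1 (n + 1)) hs0 hk hkd hn hy ha hl hi
        (by omega) fun j h0 h1 c hc => ?_
      refine lv_star_eq_of_mem_vals (by omega) hy ha hwa (fun f hf => (IHf f hf).1)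
        (fun j h0 h1 => (D j h0 h1).1) h0 (by omega) ?_ hc
      rcases eq_or_lt_of_le h0 with rfl | h2
      · exact hV c
      · exact (D j h2 (by omega)).2 c
  exact fun i h0 h1 => (key (2 ^ s - 1 - i) i h0 (by omega)).1

/-! ### Return to the natural numbers -/

theorem star_neg_natCast {n x y : ℕ} (hx : x < 2 ^ n) (hy : y < 2 ^ n) :
    star (-(x : Z n)) (-(y : Z n)) = -((op n x y : ℕ) : Z n) := by
  rw [star, neg_neg, neg_neg, ZMod.val_natCast_of_lt hx, ZMod.val_natCast_of_lt hy]

theorem eq_of_natCast_eq {n a b : ℕ} (ha : a < 2 ^ n) (hb : b < 2 ^ n)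
    (h : (a : Z n) = (b : Z n)) : a = b := by
  rw [← ZMod.val_natCast_of_lt ha, h, ZMod.val_natCast_of_lt hb]

theorem op_eq_of_le {m n x y : ℕ} (h : m ≤ n) (hx : x < 2 ^ m) (hy : y < 2 ^ m) :
    op n x y = op m x y := by
  have hmn : 2 ^ m ≤ 2 ^ n := Nat.pow_le_pow_right (by norm_num) h
  have h1 : op n x y < 2 ^ m := by
    rcases eq_or_ne x 0 with rfl | h0
    · rwa [op_zero]
    · exact (op_lt_left n x y h0).trans hx
  have h2 := red_star h (-(x : Z n)) (-(y : Z n))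
  rw [star_neg_natCast (hx.trans_le hmn) (hy.trans_le hmn), map_neg, map_neg, map_neg,
    map_natCast, map_natCast, map_natCast, star_neg_natCast hx hy, neg_inj] at h2
  exact eq_of_natCast_eq h1 (op_lt m x y hx hy) h2

theorem bs_eq_op {n x y : ℕ} (hx : x < 2 ^ n) (hy : y < 2 ^ n) : bs x y = op n x y := by
  have h := Nat.lt_size_self (max x y)
  exact (op_eq_of_le (Nat.size_le.2 (max_lt hx hy)) ((le_max_left _ _).trans_lt h)
    ((le_max_right _ _).trans_lt h)).symm

theorem star_neg_natCast_eq_bs {n x y : ℕ} (hx : x < 2 ^ n) (hy : y < 2 ^ n) :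
    star (-(x : Z n)) (-(y : Z n)) = -((bs x y : ℕ) : Z n) := by
  rw [star_neg_natCast hx hy, bs_eq_op hx hy]

theorem bs_zero_right (x : ℕ) : bs x 0 = 0 := by
  have hx : x < 2 ^ x := Nat.lt_two_pow_self
  have h := star_neg_natCast_eq_bs hx (y := 0) (by positivity)
  rw [Nat.cast_zero, neg_zero, star_zero, zero_eq_neg] at h
  refine eq_of_natCast_eq ?_ (by positivity) (h.trans Nat.cast_zero.symm)
  rw [bs_eq_op hx (by positivity)]
  exact op_lt _ _ _ hx (by positivity)

theorem bs_lt_left {x : ℕ} (hx : x ≠ 0) (y : ℕ) : bs x y < x := op_lt_left _ x y hx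

theorem lv_eq_of_periodic {n x l : ℕ} (hx : x < 2 ^ n) (h : Function.Periodic (bs x) (2 ^ l)) :
    lv (-(x : Z n)) l = n := by
  rcases le_or_gt n l with hl | hl
  · exact lv_of_le _ hl
  have hle : 2 ^ l ≤ 2 ^ n := Nat.pow_le_pow_right (by norm_num) hl.le
  have hpos : 0 < 2 ^ l := by positivity
  have h0 : bs x (2 ^ n - 2 ^ l) = 0 := by
    have h1 : 2 ^ n - 2 ^ l = (2 ^ (n - l) - 1) * 2 ^ l := by
      rw [Nat.sub_mul, ← pow_add, Nat.sub_add_cancel hl.le, one_mul]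
    have h2 := h.nat_mul (2 ^ (n - l) - 1) 0
    rw [zero_add, Nat.cast_id, bs_zero_right] at h2
    rw [h1, h2]
  have h3 := star_neg_natCast_eq_bs hx (y := 2 ^ n - 2 ^ l) (by omega)
  rw [h0, Nat.cast_sub hle, ZMod.natCast_self] at h3
  push_cast at h3
  rw [zero_sub, neg_neg, neg_zero] at h3
  rw [lv, h3, lev_zero]

theorem bs_add_two_pow {x s k l : ℕ} (hs : 0 < s) (hx : 2 ^ s ∣ x) (hk : 2 ^ k ∣ s)
    (hlk : l ≤ 2 ^ k) (hl : Function.Periodic (bs (x + 1)) (2 ^ l)) (i : ℕ) {i' : ℕ}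
    (hi : i' < 2 ^ s) : bs (x + 2 ^ s) (2 ^ s * i + i') = bs (x + 1) i + i' := by
  obtain ⟨n, hn⟩ : ∃ n, x + 2 ^ s + (2 ^ s * i + i') < 2 ^ n := ⟨_, Nat.lt_two_pow_self⟩
  have hp : 0 < 2 ^ s := by positivity
  have hii : i ≤ 2 ^ s * i := Nat.le_mul_of_pos_left i hp
  have hlt := bs_lt_left (x := x + 1) (by omega) i
  have hy : -((x + 1 : ℕ) : Z n) + 1 = -((x + 2 ^ s : ℕ) : Z n) + 2 ^ s := by push_cast; ring
  have ha : (2 : Z n) ^ s ∣ -((x + 2 ^ s : ℕ) : Z n) := by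
    rw [dvd_neg]
    have := Nat.cast_dvd_cast (α := Z n) (dvd_add hx (dvd_refl (2 ^ s)))
    rwa [Nat.cast_pow, Nat.cast_ofNat] at this
  have hlv : lv (-((x + 1 : ℕ) : Z n)) (2 ^ k) = n :=
    lv_eq_of_le (lv_eq_of_periodic (by omega) hl) hlk
  obtain ⟨R, C⟩ := rowShape hs n k hk _ _ hy ha hlv
  -- Negation reverses the order inside a block: these choices make the argument -(2^s i + i') and
  -- f+1 equal to -i.
  have h := star_base hk hy ha hlv R C (-(i : Z n) - 1) (i := 2 ^ s - i') (by omega) (by omega)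
  have e : (2 : Z n) ^ s * (-(i : Z n) - 1) + ((2 ^ s - i' : ℕ) : Z n)
      = -((2 ^ s * i + i' : ℕ) : Z n) := by
    rw [Nat.cast_sub hi.le]; push_cast; ring
  rw [e, star_neg_natCast_eq_bs (by omega) (by omega), sub_add_cancel,
    star_neg_natCast_eq_bs (by omega) (by omega), Nat.cast_sub hi.le] at h
  have hlt' := bs_lt_left (x := x + 2 ^ s) (by omega) (2 ^ s * i + i')
  refine eq_of_natCast_eq (n := n) (by omega) (by omega) (neg_injective ?_)
  rw [h]
  push_cast
  ring

/-- A period q of x satisfies x\q = x\0 = 0, and the remainder of q modulo 2^s is a summand of x\q.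
So 2^s divides q, and the quotient is a period of y. -/
theorem hasPeriodLength_of_bs_eq {x y s p : ℕ}
    (h : ∀ i i' : ℕ, i' < 2 ^ s → bs x (2 ^ s * i + i') = bs y i + i')
    (hp : HasPeriodLength y p) : HasPeriodLength x (2 ^ s * p) := by
  have hpos : 0 < 2 ^ s := by positivity
  refine ⟨⟨Nat.mul_pos hpos hp.1.1, fun j => ?_⟩, fun q hq => ?_⟩
  · have hj := Nat.mod_lt j hpos
    rw [← Nat.div_add_mod j (2 ^ s), add_right_comm, ← mul_add, h _ _ hj, h _ _ hj, hp.1.2]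
  · have hj := Nat.mod_lt q hpos
    have h0 := hq.2 0
    rw [zero_add, bs_zero_right, ← Nat.div_add_mod q (2 ^ s), h _ _ hj] at h0
    have hq' : q = 2 ^ s * (q / 2 ^ s) := by
      conv_lhs => rw [← Nat.div_add_mod q (2 ^ s)]
      omega
    have hq0 : 0 < q / 2 ^ s := Nat.pos_of_ne_zero fun h1 => by
      rw [h1, mul_zero] at hq'; exact hq.1.ne' hq'
    have hper : Function.Periodic (bs y) (q / 2 ^ s) := fun j => by
      have h1 := h (j + q / 2 ^ s) 0 hpos
      have h2 := h j 0 hpos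
      rw [add_zero, add_zero] at h1 h2
      rw [← h1, ← h2, mul_add, ← hq', hq.2]
    rw [hq']
    exact Nat.mul_le_mul_left _ (hp.2 ⟨hq0, hper⟩)

end LaverB

theorem lemma4p4 (x s l : ℕ) (hx : 2 ^ s ∣ x)
    (hl : LaverB.HasPeriodLength (x + 1) (2 ^ l))
    (hs : ∃ k : ℕ, 2 ^ k ∣ s ∧ l ≤ 2 ^ k) :
    (∀ i i' : ℕ, i' < 2 ^ s →
      LaverB.bs (x + 2 ^ s) (2 ^ s * i + i') = LaverB.bs (x + 1) i + i') ∧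
    LaverB.HasPeriodLength (x + 2 ^ s) (2 ^ (l + s)) := by
  have main : ∀ i i' : ℕ, i' < 2 ^ s →
      LaverB.bs (x + 2 ^ s) (2 ^ s * i + i') = LaverB.bs (x + 1) i + i' := by
    intro i i' hi
    -- `rowShape` needs s > 0; for s = 0 both sides coincide.
    rcases Nat.eq_zero_or_pos s with rfl | h0
    · obtain rfl : i' = 0 := by simpa using hi
      simp
    · obtain ⟨k, hk, hlk⟩ := hs
      exact LaverB.bs_add_two_pow h0 hx hk hlk hl.1.2 i hi
  refine ⟨main, ?_⟩
  rw [add_comm l, pow_add]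
  exact LaverB.hasPeriodLength_of_bs_eq main hl
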